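/- Let $d\ge 2$ and let $\Gamma$ be a finite-index subgroup of $\mathbb{Z}^d$. Let $S\subset\Gamma$ be a finite set that generates $\Gamma$ as a group and satisfies $S=-S$ and $0\notin S$. Endow $\Gamma$ with the Cayley graph structure given by $S$: two vertices $u,v\in\Gamma$ are adjacent if and only if $u-v\in S$. Assume that for every $i\in\{1,\dots,d\}$: (i) the set $\{x\in\Gamma : x_i=0\}$ is a connected subset of this graph (i.e. the subgraph it induces is connected); (ii) for any pair $(x,z)$ of adjacent vertices with $x_i\le 0\le z_i$, we have $x_i=0$ or $z_i=0$. For each prime $p$, let $B_p$ be a uniformly random coset of $p\Gamma$ in $\Gamma$, these cosets being chosen independently for distinct primes. Call $v\in\Gamma$ white if $v\in W:=\Gamma\setminus\bigcup_{p\text{ prime}}B_p$, and black otherwise. A white (resp. black) cluster is a connected component of the subgraph induced on the set of white (resp. black) vertices. Then, almost surely, the number of infinite white clusters is equal to $1$ and the number of infinite black clusters is equal to $0$. -/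

import Mathlib

open MeasureTheory ProbabilityTheory

namespace CoprimePercolation

/-- A subset `S` of an abelian group is an admissible generating set: it is finite,
symmetric, does not contain `0`, and generates the group. -/
structure Admissible {A : Type*} [AddCommGroup A] (S : Set A) : Prop where
  finite : S.Finite
  neg_mem : ∀ s ∈ S, -s ∈ S
  zero_notMem : (0 : A) ∉ S
  closure_eq_top : AddSubgroup.closure S = ⊤

/-- The Cayley graph of an abelian group with respect to an admissible generating set `S`:
`u` and `v` are adjacent if and only if `u - v ∈ S`. -/
def cayleyGraph {A : Type*} [AddCommGroup A] (S : Set A) (hS : Admissible S) :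
    SimpleGraph A where
  Adj u v := u - v ∈ S
  symm := ⟨fun u v h => by simpa using hS.neg_mem _ h⟩
  loopless := ⟨fun u h => hS.zero_notMem (by simpa using h)⟩

/-- The subgroup `n A = {n a : a ∈ A}` of the abelian group `A`. -/
def multiples (A : Type*) [AddCommGroup A] (n : ℕ) : AddSubgroup A :=
  (nsmulAddMonoidHom (α := A) n).range

/-- `B p`, for `p` prime, is a random coset of `p A` in `A` (a random element of `A ⧸ p A`);
each `B p` is uniformly distributed and the family is independent. The set of cosets carries
the σ-algebra of all its subsets. -/
structure IsUniformCosetFamily {A : Type*} [AddCommGroup A] {Ω : Type*} [MeasurableSpace Ω]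
    (P : Measure Ω) (B : (p : Nat.Primes) → Ω → A ⧸ multiples A (p : ℕ)) : Prop where
  measurable : ∀ p, Measurable[_, ⊤] (B p)
  uniform : ∀ (p : Nat.Primes) (c : A ⧸ multiples A (p : ℕ)),
    P {ω | B p ω = c} = (Nat.card (A ⧸ multiples A (p : ℕ)) : ENNReal)⁻¹
  indep : iIndepFun (m := fun _ => ⊤) B P

/-- The set `W = A \ ⋃ p, b p` of white vertices, given one coset `b p` of `p A` for every
prime `p`. The black vertices are the elements of the complement. -/
def white {A : Type*} [AddCommGroup A] (b : (p : Nat.Primes) → A ⧸ multiples A (p : ℕ)) :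
    Set A :=
  {v | ∀ p : Nat.Primes, (QuotientAddGroup.mk v : A ⧸ multiples A (p : ℕ)) ≠ b p}

/-- The number (possibly `⊤`) of infinite connected components of the subgraph of `G`
induced on the set `U` of vertices. -/
noncomputable def numInfiniteClusters {V : Type*} (G : SimpleGraph V) (U : Set V) : ℕ∞ :=
  {C : (G.induce U).ConnectedComponent | C.supp.Infinite}.encard

end CoprimePercolation

/-!
At scale `L = 2 ^ 2 ^ k`, look for hyperplanes `x i = a` with `a` of order `± L` all of whose
vertices in a box of radius of order `L ^ 2` are white. If they exist for each `i` and each sign,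
then they form a white shell around the origin. By the crossing hypothesis no path jumps over a
hyperplane, so every infinite cluster, white or black, that visits the interior of the shell has a
vertex on it; by the connectivity hypothesis the white hyperplane pieces are connected (up to a
bounded margin, see `IsLatticeFrame.exists_linked_hyperplane`). As the pieces at scale `L` reach
as far as scale `L ^ 2`, consecutive shells meet, and all shells at large scales belong to a
single infinite white cluster. Hence there is no other infinite white cluster and no infinite
black one: this is `IsShellFamily.numInfiniteClusters_eq_one` and
`IsShellFamily.numInfiniteClusters_compl`.

It remains to find the shells almost surely at all large scales. A coset `B p` with `p` larger
than `L ^ 8` typically misses the box altogether, by the Borel–Cantelli lemma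
(`IsUniformCosetFamily.ae_finite_setOf_meets_box`). A smaller prime leaves the hyperplane white
unless `a` lies in one random residue class modulo `p`, so one has to find an integer `a` in an
interval of length `L` that avoids a uniformly random class modulo each `p ≤ L ^ 8`. The primes up
to a small multiple of `log L` are avoided deterministically by the Chinese remainder theorem, and
the remaining ones by a second moment argument over an arithmetic progression with
polylogarithmically many terms. Its terms survive almost independently, since a difference of two terms
has boundedly many prime factors in the relevant range, and the survival probability is at least a power of
`1 / log L`, by Chebyshev's bound on primorials. The failure probability is of order `1 / log L`,
that is `2 ^ (-k)`, which is summable over the scales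
(`IsUniformResidueFamily.ae_eventually_exists`).

The lattice is handled through the coordinates `f i`, the standard ones divided by the generators
of their images. They do not map `Γ` onto `ℤ ^ d` in general, so two hyperplanes `f i = a` and
`f j = a'` need not intersect. Therefore the residues of the `a` modulo the index `N` of `Γ` are
prescribed, in such a way that the hyperplanes in one fixed direction meet those in all other
directions, and that no `B p` with `p` dividing `N` meets any of them
(`IsLatticeFrame.exists_compatible_residues`).
-/

namespace CoprimePercolation

/-! ### Avoiding one residue class modulo each prime -/

theorem not_dvd_prod_of_notMem {s : Finset Nat.Primes} {q : Nat.Primes} (hq : q ∉ s) :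
    ¬ (q : ℕ) ∣ ∏ p ∈ s, (p : ℕ) := by
  rw [q.2.prime.dvd_finsetProd_iff]
  rintro ⟨r, hr, hqr⟩
  have : q = r := Subtype.ext ((Nat.prime_dvd_prime_iff_eq q.2 r.2).1 hqr)
  exact hq (this ▸ hr)

theorem exists_int_avoiding (s : Finset Nat.Primes) (c : (p : Nat.Primes) → ZMod (p : ℕ)) :
    ∃ t : ℤ, ∀ p ∈ s, (t : ZMod (p : ℕ)) ≠ c p := by
  classical
  induction s using Finset.induction_on with
  | empty => exact ⟨0, by simp⟩
  | insert q s hq ih =>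
    obtain ⟨t, ht⟩ := ih
    by_cases h : (t : ZMod (q : ℕ)) = c q
    · -- Adding the product of the primes in `s` only changes the residue modulo `q`.
      refine ⟨t + ∏ p ∈ s, (p : ℕ), fun p hp => ?_⟩
      rcases Finset.mem_insert.1 hp with rfl | hp
      · rw [← h]
        push_cast
        intro h0
        have h1 : ((∏ x ∈ s, (x : ℕ) : ℕ) : ZMod (p : ℕ)) = 0 := by
          push_cast
          simpa using h0
        exact not_dvd_prod_of_notMem hq ((ZMod.natCast_eq_zero_iff _ _).1 h1)
      · have h1 : ((∏ x ∈ s, (x : ℕ) : ℕ) : ZMod (p : ℕ)) = 0 := by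
          rw [ZMod.natCast_eq_zero_iff]
          exact Finset.dvd_prod_of_mem (fun x : Nat.Primes => (x : ℕ)) hp
        have h2 : (((t + ∏ p ∈ s, ((p : ℕ) : ℤ) : ℤ)) : ZMod (p : ℕ)) = t := by
          push_cast at h1 ⊢
          rw [h1, add_zero]
        push_cast at h2 ⊢
        rw [h2]
        exact ht p hp
    · refine ⟨t, fun p hp => ?_⟩
      rcases Finset.mem_insert.1 hp with rfl | hp
      · exact h
      · exact ht p hp

/-- The prime numbers in the interval `(a, b]`. -/
def primesIoc (a b : ℕ) : Finset Nat.Primes :=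
  (Finset.Ioc a b).subtype Nat.Prime

theorem mem_primesIoc {a b : ℕ} {p : Nat.Primes} :
    p ∈ primesIoc a b ↔ a < (p : ℕ) ∧ (p : ℕ) ≤ b := by
  exact Finset.mem_subtype.trans Finset.mem_Ioc

theorem prod_primesIoc (a b : ℕ) (g : ℕ → ℝ) :
    ∏ p ∈ primesIoc a b, g p = ∏ p ∈ (Finset.Ioc a b).filter Nat.Prime, g p :=
  Finset.prod_subtype_eq_prod_filter (s := Finset.Ioc a b) (p := Nat.Prime) g

theorem exists_int_avoiding_Ico (y : ℕ) (s : ℤ) (c : (p : Nat.Primes) → ZMod (p : ℕ)) :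
    ∃ t : ℤ, s ≤ t ∧ t < s + primorial y ∧
      ∀ p : Nat.Primes, (p : ℕ) ≤ y → (t : ZMod (p : ℕ)) ≠ c p := by
  obtain ⟨t, ht⟩ := exists_int_avoiding (primesIoc 0 y) c
  have hQ : (0 : ℤ) < primorial y := by exact_mod_cast primorial_pos y
  refine ⟨s + (t - s) % primorial y, ?_, ?_, fun p hp => ?_⟩
  · have := Int.emod_nonneg (t - s) hQ.ne'
    linarith
  · have := Int.emod_lt_of_pos (t - s) hQ
    linarith
  · have h0 : ((primorial y : ℕ) : ZMod (p : ℕ)) = 0 := by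
      rw [ZMod.natCast_eq_zero_iff]
      exact p.2.dvd_primorial_iff.2 hp
    have h1 : s + (t - s) % primorial y = t - primorial y * ((t - s) / primorial y) := by
      have := Int.emod_add_mul_ediv (t - s) (primorial y)
      linarith
    rw [h1]
    push_cast
    rw [h0, zero_mul, sub_zero]
    exact ht p (mem_primesIoc.2 ⟨p.2.pos, hp⟩)

/-! ### Elementary estimates on primes -/

theorem card_primes_dyadic (m : ℕ) :
    m * ((Finset.Ioc (2 ^ m) (2 ^ (m + 1))).filter Nat.Prime).card ≤ 4 * 2 ^ m := by
  set s := (Finset.Ioc (2 ^ m) (2 ^ (m + 1))).filter Nat.Prime with hs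
  have h1 : (2 ^ m) ^ s.card ≤ ∏ p ∈ s, p := by
    refine Finset.pow_card_le_prod s _ _ fun p hp => ?_
    simp only [hs, Finset.mem_filter, Finset.mem_Ioc] at hp
    exact hp.1.1.le
  have h2 : ∏ p ∈ s, p ≤ primorial (2 ^ (m + 1)) := by
    refine Finset.prod_le_prod_of_subset_of_one_le' (fun p hp => ?_) fun p hp _ => ?_
    · simp only [hs, Finset.mem_filter, Finset.mem_Ioc, Finset.mem_range] at hp ⊢
      exact ⟨by omega, hp.2⟩
    · exact (Finset.mem_filter.1 hp).2.one_lt.le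
  have h3 := h1.trans (h2.trans (primorial_le_four_pow _))
  rw [show (4 : ℕ) = 2 ^ 2 from rfl, ← pow_mul, ← pow_mul] at h3
  have h4 := (Nat.pow_le_pow_iff_right (by norm_num : 1 < 2)).1 h3
  rw [pow_succ] at h4
  omega

/-- A weak form of Mertens' theorem: `∏_{p ≤ x} (1 - 1/p)` is bounded below by a power
of `1 / log x`. -/
theorem exists_le_prod_one_sub_inv :
    ∃ c : ℝ, 0 < c ∧ ∀ m : ℕ, 9 ≤ m →
      c / (m : ℝ) ^ 6 ≤ ∏ p ∈ (Finset.Ioc 0 (2 ^ m)).filter Nat.Prime, (1 - 1 / (p : ℝ)) := by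
  have hfac : ∀ p : ℕ, p.Prime → 0 < 1 - 1 / (p : ℝ) := fun p hp => by
    have h2 : (1 : ℝ) < p := by exact_mod_cast hp.one_lt
    have : 1 / (p : ℝ) < 1 := by rw [div_lt_one (by linarith)]; exact h2
    linarith
  set c₀ := ∏ p ∈ (Finset.Ioc 0 (2 ^ 9)).filter Nat.Prime, (1 - 1 / (p : ℝ)) with hc₀
  have hc₀p : 0 < c₀ := Finset.prod_pos fun p hp => hfac p (Finset.mem_filter.1 hp).2
  refine ⟨c₀, hc₀p, fun m hm => ?_⟩
  -- The primes in `(2 ^ m, 2 ^ (m + 1)]` contribute a factor at least `1 - 4 / m`, and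
  -- `(m / (m + 1)) ^ 6 ≤ 1 - 4 / m` for `m ≥ 9`.
  have key : c₀ * 9 ^ 6 / (m : ℝ) ^ 6 ≤
      ∏ p ∈ (Finset.Ioc 0 (2 ^ m)).filter Nat.Prime, (1 - 1 / (p : ℝ)) := by
    induction m, hm using Nat.le_induction with
    | base => rw [hc₀]; norm_num
    | succ m hm ih =>
      have hm0 : (0 : ℝ) < m := by exact_mod_cast (by omega : 0 < m)
      have hm9 : (9 : ℝ) ≤ m := by exact_mod_cast hm
      set s := (Finset.Ioc (2 ^ m) (2 ^ (m + 1))).filter Nat.Prime with hs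
      have hsplit : (Finset.Ioc 0 (2 ^ (m + 1))).filter Nat.Prime =
          (Finset.Ioc 0 (2 ^ m)).filter Nat.Prime ∪ s := by
        rw [hs, ← Finset.filter_union, Finset.Ioc_union_Ioc_eq_Ioc (by positivity)
          (Nat.pow_le_pow_right (by norm_num) (by omega))]
      have hdisj : Disjoint ((Finset.Ioc 0 (2 ^ m)).filter Nat.Prime) s :=
        Finset.disjoint_filter_filter (Finset.disjoint_left.2 fun x hx hx' => by
          simp only [Finset.mem_Ioc] at hx hx'; omega)
      rw [hsplit, Finset.prod_union hdisj]
      have hpow : (0 : ℝ) < 2 ^ m := by positivity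
      have hpow1 : (1 : ℝ) ≤ 2 ^ m := one_le_pow₀ (by norm_num)
      have hblock : 1 - 4 / (m : ℝ) ≤ ∏ p ∈ s, (1 - 1 / (p : ℝ)) := by
        have h1 : (1 - 1 / (2 : ℝ) ^ m) ^ s.card ≤ ∏ p ∈ s, (1 - 1 / (p : ℝ)) := by
          rw [← Finset.prod_const]
          refine Finset.prod_le_prod (fun p _ => ?_) fun p hp => ?_
          · rw [sub_nonneg, div_le_one hpow]
            exact hpow1
          · simp only [hs, Finset.mem_filter, Finset.mem_Ioc] at hp
            have : (2 : ℝ) ^ m ≤ p := by exact_mod_cast hp.1.1.le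
            have := one_div_le_one_div_of_le hpow this
            linarith
        have h2 : 1 + (s.card : ℝ) * (-(1 / 2 ^ m)) ≤ (1 + -(1 / (2 : ℝ) ^ m)) ^ s.card := by
          refine one_add_mul_le_pow ?_ _
          have : 1 / (2 : ℝ) ^ m ≤ 1 := by rw [div_le_one hpow]; exact hpow1
          linarith
        have h3 : (s.card : ℝ) / 2 ^ m ≤ 4 / m := by
          rw [div_le_div_iff₀ hpow hm0]
          have := card_primes_dyadic m
          have h4 : ((m * s.card : ℕ) : ℝ) ≤ ((4 * 2 ^ m : ℕ) : ℝ) := by exact_mod_cast this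
          push_cast at h4
          linarith
        have h5 : (s.card : ℝ) * (-(1 / 2 ^ m)) = -((s.card : ℝ) / 2 ^ m) := by ring
        rw [h5] at h2
        rw [sub_eq_add_neg 1 (1 / (2 : ℝ) ^ m)] at h1
        linarith
      have hpos : 0 ≤ 1 - 4 / (m : ℝ) := by
        rw [sub_nonneg, div_le_one hm0]
        linarith
      refine le_trans ?_ (mul_le_mul ih hblock hpos (le_trans (by positivity) ih))
      rw [div_mul_eq_mul_div, div_le_div_iff₀ (by positivity) (by positivity)]
      push_cast
      have h6 : (m : ℝ) ^ 6 ≤ (1 - 4 / (m : ℝ)) * ((m : ℝ) + 1) ^ 6 := by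
        have h7 : (1 - 4 / (m : ℝ)) * ((m : ℝ) + 1) ^ 6 =
            ((m : ℝ) - 4) * ((m : ℝ) + 1) ^ 6 / m := by field_simp
        rw [h7, le_div_iff₀ hm0]
        have h8 : ∃ t : ℝ, 0 ≤ t ∧ (m : ℝ) = 9 + t := ⟨m - 9, by linarith, by ring⟩
        obtain ⟨t, ht, h8⟩ := h8
        rw [h8]
        have : 0 ≤ (9 + t - 4) * (9 + t + 1) ^ 6 - (9 + t) ^ 6 * (9 + t) := by
          ring_nf
          positivity
        linarith
      calc c₀ * 9 ^ 6 * (m : ℝ) ^ 6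
          ≤ c₀ * 9 ^ 6 * ((1 - 4 / (m : ℝ)) * ((m : ℝ) + 1) ^ 6) := by gcongr
        _ = _ := by ring
  refine le_trans ?_ key
  gcongr
  nlinarith

theorem card_primes_dvd_le {y A : ℕ} (s : Finset Nat.Primes) (hs : ∀ p ∈ s, y < (p : ℕ))
    {h : ℤ} (h0 : h ≠ 0) (hlt : h.natAbs < y ^ (A + 1)) :
    (s.filter fun p : Nat.Primes => ((p : ℕ) : ℤ) ∣ h).card ≤ A := by
  set D := s.filter fun p : Nat.Primes => ((p : ℕ) : ℤ) ∣ h with hD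
  have h1 : y ^ D.card ≤ ∏ p ∈ D, (p : ℕ) :=
    Finset.pow_card_le_prod D _ _ fun p hp => (hs p (Finset.mem_filter.1 hp).1).le
  have h2 : ((∏ p ∈ D, (p : ℕ) : ℕ) : ℤ) ∣ h := by
    push_cast
    refine Finset.prod_dvd_of_coprime ?_ fun p hp => (Finset.mem_filter.1 hp).2
    intro p _ q _ hpq
    exact Nat.isCoprime_iff_coprime.2
      ((Nat.coprime_primes p.2 q.2).2 fun h => hpq (Subtype.ext h))
  have h3 := Nat.le_of_dvd (Int.natAbs_pos.2 h0) (Int.natCast_dvd.1 h2)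
  by_contra! hcon
  have hy : 0 < y := by
    rcases Nat.eq_zero_or_pos y with rfl | h
    · simp at hlt
    · exact h
  have := Nat.pow_le_pow_right hy (show A + 1 ≤ D.card by omega)
  omega

/-- The sieving product over a range of primes, bounded below uniformly in the start of
the range. -/
theorem exists_le_prod_primesIoc :
    ∃ c : ℝ, 0 < c ∧ ∀ m y : ℕ, 9 ≤ m →
      c / (m : ℝ) ^ 6 ≤ ∏ p ∈ primesIoc y (2 ^ m), (1 - 1 / ((p : ℕ) : ℝ)) := by
  obtain ⟨c, hc, h⟩ := exists_le_prod_one_sub_inv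
  refine ⟨c, hc, fun m y hm => (h m hm).trans ?_⟩
  rw [prod_primesIoc y (2 ^ m) fun p => 1 - 1 / (p : ℝ)]
  refine Finset.prod_le_prod_of_subset_of_le_one ?_ ?_ ?_
  · exact Finset.filter_subset_filter _ (Finset.Ioc_subset_Ioc_left (Nat.zero_le _))
  · intro p hp
    have : (1 : ℝ) ≤ p := by exact_mod_cast (Finset.mem_filter.1 hp).2.one_lt.le
    rw [sub_nonneg, div_le_one (by linarith)]
    exact this
  · intro p _ _
    have : 0 ≤ 1 / (p : ℝ) := by positivity
    linarith

/-! ### Second moment method -/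

theorem measureReal_forall_notMem_le {Ω : Type*} [MeasurableSpace Ω] (P : Measure Ω)
    [IsProbabilityMeasure P] {J : ℕ} (hJ : 0 < J) (A : ℕ → Set Ω)
    (hA : ∀ j, MeasurableSet (A j)) {q ε : ℝ} (hq : 0 < q) (hε : 0 ≤ ε)
    (h1 : ∀ j < J, P.real (A j) = q)
    (h2 : ∀ j < J, ∀ j' < J, j ≠ j' → P.real (A j ∩ A j') ≤ (1 + ε) * q ^ 2) :
    P.real {ω | ∀ j < J, ω ∉ A j} ≤ 1 / (J * q) + ε := by
  have hJ' : (0 : ℝ) < J := by exact_mod_cast hJ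
  set E := {ω | ∀ j < J, ω ∉ A j} with hE
  have hEm : MeasurableSet E := by
    have : E = ⋂ j, ⋂ _ : j < J, (A j)ᶜ := by ext ω; simp [hE]
    rw [this]
    exact MeasurableSet.iInter fun j => MeasurableSet.iInter fun _ => (hA j).compl
  let g : ℕ → Ω → ℝ := fun j => (A j).indicator 1
  have hgi : ∀ j, Integrable (g j) P := fun j => (integrable_const (1 : ℝ)).indicator (hA j)
  have hgint : ∀ j, ∫ ω, g j ω ∂P = P.real (A j) := fun j => integral_indicator_one (hA j)
  have hgg : ∀ j j', (fun ω => g j ω * g j' ω) = (A j ∩ A j').indicator 1 := fun j j' => by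
    ext ω
    simp only [g]
    by_cases ha : ω ∈ A j <;> by_cases hb : ω ∈ A j' <;> simp [ha, hb]
  have hggi : ∀ j j', Integrable (fun ω => g j ω * g j' ω) P := fun j j' => by
    rw [hgg]
    exact (integrable_const (1 : ℝ)).indicator ((hA j).inter (hA j'))
  have hggint : ∀ j j', ∫ ω, g j ω * g j' ω ∂P = P.real (A j ∩ A j') := fun j j' => by
    rw [hgg]
    exact integral_indicator_one ((hA j).inter (hA j'))
  let f : ℕ → Ω → ℝ := fun j ω => g j ω - q
  have hfexp : ∀ j j' ω, f j ω * f j' ω = g j ω * g j' ω - q * g j ω - q * g j' ω + q ^ 2 :=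
    fun j j' ω => by simp only [f]; ring
  have hi1 : ∀ j j', Integrable (fun ω => g j ω * g j' ω - q * g j ω) P := fun j j' =>
    (hggi j j').sub ((hgi j).const_mul q)
  have hi2 : ∀ j j', Integrable (fun ω => g j ω * g j' ω - q * g j ω - q * g j' ω) P :=
    fun j j' => (hi1 j j').sub ((hgi j').const_mul q)
  have hffi : ∀ j j', Integrable (fun ω => f j ω * f j' ω) P := fun j j' => by
    simp only [hfexp]
    exact (hi2 j j').add (integrable_const _)
  have hcov : ∀ j < J, ∀ j' < J,
      ∫ ω, f j ω * f j' ω ∂P ≤ (if j = j' then q else 0) + ε * q ^ 2 := by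
    intro j hj j' hj'
    have heq : ∫ ω, f j ω * f j' ω ∂P = P.real (A j ∩ A j') - q ^ 2 := by
      simp only [hfexp]
      rw [integral_add (hi2 j j') (integrable_const _),
        integral_sub (hi1 j j') ((hgi j').const_mul q),
        integral_sub (hggi j j') ((hgi j).const_mul q), integral_const_mul, integral_const_mul,
        hggint, hgint, hgint, h1 j hj, h1 j' hj']
      simp
      ring
    rw [heq]
    split_ifs with h
    · subst h
      rw [Set.inter_self, h1 j hj]
      nlinarith [mul_nonneg hε (sq_nonneg q), sq_nonneg q]
    · have := h2 j hj j' hj' h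
      nlinarith
  have hW : ∫ ω, (∑ j ∈ Finset.range J, f j ω) ^ 2 ∂P ≤ J * q + J ^ 2 * (ε * q ^ 2) := by
    have : ∀ ω, (∑ j ∈ Finset.range J, f j ω) ^ 2 =
        ∑ j ∈ Finset.range J, ∑ j' ∈ Finset.range J, f j ω * f j' ω := fun ω => by
      rw [sq, Finset.sum_mul_sum]
    simp only [this]
    rw [integral_finsetSum _ fun j _ => integrable_finsetSum _ fun j' _ => hffi j j']
    calc ∑ j ∈ Finset.range J, ∫ ω, ∑ j' ∈ Finset.range J, f j ω * f j' ω ∂P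
        ≤ ∑ j ∈ Finset.range J, (q + J * (ε * q ^ 2)) := by
          refine Finset.sum_le_sum fun j hj => ?_
          rw [integral_finsetSum _ fun j' _ => hffi j j']
          calc ∑ j' ∈ Finset.range J, ∫ ω, f j ω * f j' ω ∂P
              ≤ ∑ j' ∈ Finset.range J, ((if j = j' then q else 0) + ε * q ^ 2) :=
                Finset.sum_le_sum fun j' hj' =>
                  hcov j (Finset.mem_range.1 hj) j' (Finset.mem_range.1 hj')
            _ = q + J * (ε * q ^ 2) := by
                rw [Finset.sum_add_distrib, Finset.sum_ite_eq, if_pos hj]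
                simp
      _ = J * q + J ^ 2 * (ε * q ^ 2) := by
          simp
          ring
  have hlow : (J * q) ^ 2 * P.real E ≤ ∫ ω, (∑ j ∈ Finset.range J, f j ω) ^ 2 ∂P := by
    have h3 : ∫ ω, E.indicator (fun _ => ((J : ℝ) * q) ^ 2) ω ∂P = (J * q) ^ 2 * P.real E := by
      rw [integral_indicator_const _ hEm]
      simp [mul_comm]
    rw [← h3]
    refine integral_mono ((integrable_const _).indicator hEm) ?_ fun ω => ?_
    · have : ∀ ω, (∑ j ∈ Finset.range J, f j ω) ^ 2 =
          ∑ j ∈ Finset.range J, ∑ j' ∈ Finset.range J, f j ω * f j' ω := fun ω => by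
        rw [sq, Finset.sum_mul_sum]
      simp only [this]
      exact integrable_finsetSum _ fun j _ => integrable_finsetSum _ fun j' _ => hffi j j'
    · by_cases hω : ω ∈ E
      · rw [Set.indicator_of_mem hω]
        have : ∑ j ∈ Finset.range J, f j ω = -(J * q) := by
          rw [Finset.sum_congr rfl (g := fun _ => -q)]
          · simp
          · intro j hj
            have : ω ∉ A j := hω j (Finset.mem_range.1 hj)
            simp [f, g, this]
        rw [this]
        simp
      · rw [Set.indicator_of_notMem hω]
        positivity
  have hpos : 0 < ((J : ℝ) * q) ^ 2 := by positivity
  have h4 : P.real E ≤ (J * q + J ^ 2 * (ε * q ^ 2)) / (J * q) ^ 2 := by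
    rw [le_div_iff₀ hpos]
    linarith
  refine h4.trans (le_of_eq ?_)
  field_simp

/-! ### Sieving by random residue classes -/

/-- Independent residues `X p`, uniform modulo `p`, for all primes `p`. -/
structure IsUniformResidueFamily {Ω : Type*} [MeasurableSpace Ω]
    (P : Measure Ω) (X : (p : Nat.Primes) → Ω → ZMod (p : ℕ)) : Prop where
  measurable : ∀ p, Measurable (X p)
  uniform : ∀ (p : Nat.Primes) (c : ZMod (p : ℕ)), P.real {ω | X p ω = c} = 1 / ((p : ℕ) : ℝ)
  indep : iIndepFun X P

/-- The event that the integer `a` avoids the residue `X p` modulo `p`, for all `p ∈ M`. -/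
def survives {Ω : Type*} (X : (p : Nat.Primes) → Ω → ZMod (p : ℕ)) (M : Finset Nat.Primes)
    (a : ℤ) : Set Ω :=
  {ω | ∀ p ∈ M, (a : ZMod (p : ℕ)) ≠ X p ω}

section Sieve

variable {Ω : Type*} [MeasurableSpace Ω] {P : Measure Ω}
  {X : (p : Nat.Primes) → Ω → ZMod (p : ℕ)}

theorem IsUniformResidueFamily.measureReal_forall (hX : IsUniformResidueFamily P X)
    (M : Finset Nat.Primes) (C : (p : Nat.Primes) → Set (ZMod (p : ℕ))) :
    P.real {ω | ∀ p ∈ M, X p ω ∈ C p} = ∏ p ∈ M, P.real {ω | X p ω ∈ C p} := by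
  have h := hX.indep.measure_inter_preimage_eq_mul M (sets := C)
    (fun p _ => MeasurableSpace.measurableSet_top)
  have h1 : {ω | ∀ p ∈ M, X p ω ∈ C p} = ⋂ i ∈ M, X i ⁻¹' C i := by ext ω; simp
  rw [h1, Measure.real, h, ENNReal.toReal_prod]
  rfl

theorem IsUniformResidueFamily.measureReal_ne [IsProbabilityMeasure P]
    (hX : IsUniformResidueFamily P X) (p : Nat.Primes)
    (c : ZMod (p : ℕ)) : P.real {ω | c ≠ X p ω} = 1 - 1 / ((p : ℕ) : ℝ) := by
  have h1 : {ω | c ≠ X p ω} = {ω | X p ω = c}ᶜ := by ext ω; simp [eq_comm]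
  have hm : MeasurableSet {ω | X p ω = c} := hX.measurable p (measurableSet_singleton c)
  rw [h1, probReal_compl_eq_one_sub hm, hX.uniform]

theorem IsUniformResidueFamily.measureReal_ne_and_ne [IsProbabilityMeasure P]
    (hX : IsUniformResidueFamily P X)
    (p : Nat.Primes) {c c' : ZMod (p : ℕ)} (h : c ≠ c') :
    P.real {ω | c ≠ X p ω ∧ c' ≠ X p ω} = 1 - 2 / ((p : ℕ) : ℝ) := by
  have hm : ∀ c, MeasurableSet {ω | X p ω = c} :=
    fun c => hX.measurable p (measurableSet_singleton c)
  have h1 : {ω | c ≠ X p ω ∧ c' ≠ X p ω} = ({ω | X p ω = c} ∪ {ω | X p ω = c'})ᶜ := by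
    ext ω; simp [eq_comm]
  have hd : Disjoint {ω | X p ω = c} {ω | X p ω = c'} :=
    Set.disjoint_left.2 fun ω (h1 : X p ω = c) (h2 : X p ω = c') => h (h1.symm.trans h2)
  rw [h1, probReal_compl_eq_one_sub ((hm c).union (hm c')), measureReal_union hd (hm c'),
    hX.uniform, hX.uniform]
  ring

theorem IsUniformResidueFamily.measurableSet_survives (hX : IsUniformResidueFamily P X)
    (M : Finset Nat.Primes) (a : ℤ) : MeasurableSet (survives X M a) := by
  have : survives X M a = ⋂ p ∈ M, X p ⁻¹' {(a : ZMod (p : ℕ))}ᶜ := by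
    ext ω; simp [survives, eq_comm]
  rw [this]
  exact Finset.measurableSet_biInter _ fun p _ =>
    hX.measurable p (MeasurableSpace.measurableSet_top)

theorem IsUniformResidueFamily.measureReal_survives [IsProbabilityMeasure P]
    (hX : IsUniformResidueFamily P X)
    (M : Finset Nat.Primes) (a : ℤ) :
    P.real (survives X M a) = ∏ p ∈ M, (1 - 1 / ((p : ℕ) : ℝ)) := by
  have h := hX.measureReal_forall M fun p => {c | (a : ZMod (p : ℕ)) ≠ c}
  simp only [Set.mem_ofPred_eq] at h
  rw [survives, h]
  exact Finset.prod_congr rfl fun p _ => hX.measureReal_ne p _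

/-- Two integers whose difference has few prime factors in `M` survive almost
independently: only common factors create positive correlation. -/
theorem IsUniformResidueFamily.measureReal_survives_inter_le [IsProbabilityMeasure P]
    (hX : IsUniformResidueFamily P X)
    {M : Finset Nat.Primes} {a a' : ℤ} {y A : ℕ} (hM : ∀ p ∈ M, y < (p : ℕ)) (hy : 0 < y)
    (hyA : 2 * A ≤ y) (hcard : (M.filter fun p : Nat.Primes => ((p : ℕ) : ℤ) ∣ a - a').card ≤ A) :
    P.real (survives X M a ∩ survives X M a') ≤
      (1 + 2 * A / y) * (∏ p ∈ M, (1 - 1 / ((p : ℕ) : ℝ))) ^ 2 := by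
  have h := hX.measureReal_forall M
    fun p => {c | (a : ZMod (p : ℕ)) ≠ c ∧ (a' : ZMod (p : ℕ)) ≠ c}
  simp only [Set.mem_ofPred_eq] at h
  have h0 : survives X M a ∩ survives X M a' =
      {ω | ∀ p ∈ M, (a : ZMod (p : ℕ)) ≠ X p ω ∧ (a' : ZMod (p : ℕ)) ≠ X p ω} := by
    ext ω
    simp only [survives, Set.mem_inter_iff, Set.mem_ofPred_eq]
    exact ⟨fun h p hp => ⟨h.1 p hp, h.2 p hp⟩, fun h => ⟨fun p hp => (h p hp).1,
      fun p hp => (h p hp).2⟩⟩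
  rw [h0, h]
  have hyr : (0 : ℝ) < y := by exact_mod_cast hy
  have hp1 : ∀ p : Nat.Primes, 0 ≤ 1 - 1 / ((p : ℕ) : ℝ) := fun p => by
    have : (1 : ℝ) ≤ (p : ℕ) := by exact_mod_cast p.2.one_lt.le
    rw [sub_nonneg, div_le_one (by linarith)]
    exact this
  set D := M.filter fun p : Nat.Primes => ((p : ℕ) : ℤ) ∣ a - a' with hD
  set R := ∏ p ∈ M, P.real {ω | (a : ZMod (p : ℕ)) ≠ X p ω ∧ (a' : ZMod (p : ℕ)) ≠ X p ω} with hR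
  have hR0 : 0 ≤ R := Finset.prod_nonneg fun p _ => measureReal_nonneg
  have h1 : R * ∏ p ∈ D, (1 - 1 / ((p : ℕ) : ℝ)) ≤ (∏ p ∈ M, (1 - 1 / ((p : ℕ) : ℝ))) ^ 2 := by
    rw [hD, Finset.prod_filter, hR, ← Finset.prod_mul_distrib, ← Finset.prod_pow]
    refine Finset.prod_le_prod (fun p _ => ?_) fun p _ => ?_
    · refine mul_nonneg measureReal_nonneg ?_
      split_ifs
      · exact hp1 p
      · exact zero_le_one
    · split_ifs with hd
      · have : P.real {ω | (a : ZMod (p : ℕ)) ≠ X p ω ∧ (a' : ZMod (p : ℕ)) ≠ X p ω} ≤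
            1 - 1 / ((p : ℕ) : ℝ) := by
          rw [← hX.measureReal_ne p a]
          exact measureReal_mono fun ω hω => hω.1
        nlinarith [hp1 p]
      · have hne : (a : ZMod (p : ℕ)) ≠ (a' : ZMod (p : ℕ)) := fun h => hd <| by
          rw [← sub_eq_zero, ← Int.cast_sub, ZMod.intCast_zmod_eq_zero_iff_dvd _ (p : ℕ)] at h
          exact h
        rw [hX.measureReal_ne_and_ne p hne]
        have : (1 - 1 / ((p : ℕ) : ℝ)) ^ 2 = 1 - 2 / ((p : ℕ) : ℝ) + (1 / ((p : ℕ) : ℝ)) ^ 2 := by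
          ring
        nlinarith [sq_nonneg (1 / ((p : ℕ) : ℝ))]
  have hyA' : (2 * A : ℝ) ≤ y := by exact_mod_cast hyA
  have hy1 : (1 : ℝ) ≤ y := by exact_mod_cast hy
  have h2 : 1 - (A : ℝ) / y ≤ ∏ p ∈ D, (1 - 1 / ((p : ℕ) : ℝ)) := by
    have h3 : (1 - 1 / (y : ℝ)) ^ D.card ≤ ∏ p ∈ D, (1 - 1 / ((p : ℕ) : ℝ)) := by
      rw [← Finset.prod_const]
      refine Finset.prod_le_prod (fun p _ => ?_) fun p hp => ?_
      · rw [sub_nonneg, div_le_one hyr]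
        exact hy1
      · have : (y : ℝ) ≤ (p : ℕ) := by exact_mod_cast (hM p (Finset.mem_filter.1 hp).1).le
        have := one_div_le_one_div_of_le hyr this
        linarith
    have hinv : 1 / (y : ℝ) ≤ 1 := by rw [div_le_one hyr]; exact hy1
    have h4 : 1 + (D.card : ℝ) * (-(1 / y)) ≤ (1 + -(1 / (y : ℝ))) ^ D.card :=
      one_add_mul_le_pow (by linarith) _
    have h5 : (D.card : ℝ) * (1 / y) ≤ A * (1 / y) := by
      have : (D.card : ℝ) ≤ A := by exact_mod_cast hcard
      gcongr
    rw [← sub_eq_add_neg] at h4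
    have : (A : ℝ) / y = A * (1 / y) := by ring
    linarith
  have hx0 : 0 ≤ (A : ℝ) / y := by positivity
  have hx1 : (A : ℝ) / y ≤ 1 / 2 := by
    rw [div_le_div_iff₀ hyr (by norm_num)]
    linarith
  have h3 : R * (1 - (A : ℝ) / y) ≤ (∏ p ∈ M, (1 - 1 / ((p : ℕ) : ℝ))) ^ 2 :=
    (mul_le_mul_of_nonneg_left h2 hR0).trans h1
  have h4 : 1 ≤ (1 - (A : ℝ) / y) * (1 + 2 * A / y) := by
    have : (2 * A : ℝ) / y = 2 * (A / y) := by ring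
    rw [this]
    nlinarith
  calc R ≤ R * ((1 - (A : ℝ) / y) * (1 + 2 * A / y)) := le_mul_of_one_le_right hR0 h4
    _ = (1 + 2 * A / y) * (R * (1 - (A : ℝ) / y)) := by ring
    _ ≤ _ := mul_le_mul_of_nonneg_left h3 (by positivity)

variable [IsProbabilityMeasure P]

/-- A bound on `P {ω | V ω ∈ E t}` uniform in `t` persists when `t = τ (U ω)` is chosen as a
function of a variable `U` independent of `V`. -/
theorem measureReal_mem_of_indep {α β : Type*} [MeasurableSpace α] [MeasurableSpace β]
    {U : Ω → α} {V : Ω → β} (hUV : IndepFun U V P) (hU : Measurable U) {τ : α → ℤ}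
    (hτ : Measurable τ) (ts : Finset ℤ) (hts : ∀ u, τ u ∈ ts) {E : ℤ → Set β}
    (hE : ∀ t, MeasurableSet (E t)) {δ : ℝ} (hδ : 0 ≤ δ)
    (h : ∀ t ∈ ts, P.real {ω | V ω ∈ E t} ≤ δ) :
    P.real {ω | V ω ∈ E (τ (U ω))} ≤ δ := by
  have hsub : {ω | V ω ∈ E (τ (U ω))} ⊆ ⋃ t ∈ ts, U ⁻¹' (τ ⁻¹' {t}) ∩ V ⁻¹' E t := by
    intro ω hω
    simp only [Set.mem_iUnion]
    exact ⟨τ (U ω), hts _, rfl, hω⟩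
  have hτm : ∀ t, MeasurableSet (τ ⁻¹' {t}) := fun t => hτ (measurableSet_singleton t)
  calc P.real {ω | V ω ∈ E (τ (U ω))}
      ≤ P.real (⋃ t ∈ ts, U ⁻¹' (τ ⁻¹' {t}) ∩ V ⁻¹' E t) :=
        measureReal_mono hsub (measure_ne_top _ _)
    _ ≤ ∑ t ∈ ts, P.real (U ⁻¹' (τ ⁻¹' {t}) ∩ V ⁻¹' E t) := measureReal_biUnion_finset_le _ _
    _ ≤ ∑ t ∈ ts, P.real (U ⁻¹' (τ ⁻¹' {t})) * δ := by
        refine Finset.sum_le_sum fun t ht => ?_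
        have h1 := hUV.measure_inter_preimage_eq_mul _ _ (hτm t) (hE t)
        rw [Measure.real, h1, ENNReal.toReal_mul]
        exact mul_le_mul_of_nonneg_left (h t ht) ENNReal.toReal_nonneg
    _ = (∑ t ∈ ts, P.real (U ⁻¹' (τ ⁻¹' {t}))) * δ := by rw [Finset.sum_mul]
    _ ≤ 1 * δ := by
        refine mul_le_mul_of_nonneg_right ?_ hδ
        rw [← measureReal_biUnion_finset]
        · exact measureReal_le_one
        · intro t _ t' _ htt'
          exact Set.disjoint_left.2 fun ω (h1 : τ (U ω) = t) (h2 : τ (U ω) = t') =>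
            htt' (h1.symm.trans h2)
        · exact fun t _ => hU (hτm t)
    _ = δ := one_mul δ

/-- Quantitative sieve: with high probability, some integer `a ≡ r` modulo `N` in a prescribed
interval avoids all residues `X p`, `p ≤ T`, provided `r` does so for the divisors of `N`. -/
theorem IsUniformResidueFamily.measureReal_sieve_fail_le (hX : IsUniformResidueFamily P X)
    {y T N J A : ℕ} (r s : ℤ) (hN : 0 < N) (hNy : N ≤ y) (hJ : 0 < J) (hJy : J ≤ y ^ (A + 1))
    (hA : 2 * A ≤ y) :
    P.real {ω | (∀ p : Nat.Primes, (p : ℕ) ∣ N → (r : ZMod (p : ℕ)) ≠ X p ω) ∧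
      ∀ a : ℤ, s ≤ a → a < s + N * (primorial y * (J + 1) + 1) → a ≡ r [ZMOD N] →
        ∃ p : Nat.Primes, (p : ℕ) ≤ T ∧ (a : ZMod (p : ℕ)) = X p ω} ≤
      1 / (J * ∏ p ∈ primesIoc y T, (1 - 1 / ((p : ℕ) : ℝ))) + 2 * A / y := by
  classical
  have : ∀ p : Nat.Primes, NeZero (p : ℕ) := fun p => ⟨p.2.pos.ne'⟩
  set M := primesIoc y T with hM
  set q := ∏ p ∈ M, (1 - 1 / ((p : ℕ) : ℝ)) with hq
  set Q := primorial y with hQ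
  have hyM : ∀ p ∈ M, y < (p : ℕ) := fun p hp => (mem_primesIoc.1 hp).1
  have hy : 0 < y := by omega
  have hQpos : (0 : ℤ) < Q := by exact_mod_cast primorial_pos y
  have hNpos : (0 : ℤ) < N := by exact_mod_cast hN
  have hqpos : 0 < q := Finset.prod_pos fun p _ => by
    have : (1 : ℝ) < (p : ℕ) := by exact_mod_cast p.2.one_lt
    rw [sub_pos, div_lt_one (by linarith)]
    exact this
  -- `s ≤ r + N * s' < s + N`
  set s' : ℤ := (s - r + N - 1) / N with hs'
  have hs1 : s ≤ r + N * s' := by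
    have := Int.emod_add_mul_ediv (s - r + N - 1) N
    have := Int.emod_lt_of_pos (s - r + N - 1) hNpos
    linarith
  have hs2 : r + N * s' < s + N := by
    have := Int.emod_add_mul_ediv (s - r + N - 1) N
    have := Int.emod_nonneg (s - r + N - 1) hNpos.ne'
    linarith
  set S := primesIoc 0 y with hS
  have hdisj : Disjoint S M := Finset.disjoint_left.2 fun p h1 h2 => by
    have := (mem_primesIoc.1 h1).2
    have := hyM p h2
    omega
  have hindep := hX.indep.indepFun_finset S M hdisj hX.measurable
  -- `τ c` is such that `r + N * τ c` avoids all residues `c p` with `p ≤ y` not dividing `N`.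
  have hex : ∀ c : (p : S) → ZMod ((p : Nat.Primes) : ℕ), ∃ t : ℤ, s' ≤ t ∧ t < s' + Q ∧
      ∀ p : S, ¬ ((p : Nat.Primes) : ℕ) ∣ N →
        ((r + N * t : ℤ) : ZMod ((p : Nat.Primes) : ℕ)) ≠ c p := by
    intro c
    obtain ⟨t, h1, h2, h3⟩ := exists_int_avoiding_Ico y s' fun p =>
      if hp : p ∈ S then (c ⟨p, hp⟩ - r) * (N : ZMod (p : ℕ))⁻¹ else 0
    refine ⟨t, h1, h2, fun p hpN hcon => h3 p (mem_primesIoc.1 p.2).2 ?_⟩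
    rw [dif_pos p.2, ← hcon]
    have hco : Nat.Coprime N ((p : Nat.Primes) : ℕ) :=
      ((Nat.Prime.coprime_iff_not_dvd p.1.2).2 hpN).symm
    push_cast
    rw [add_sub_cancel_left, mul_comm (N : ZMod ((p : Nat.Primes) : ℕ)), mul_assoc,
      ZMod.coe_mul_inv_eq_one _ hco, mul_one]
  choose τ hτ1 hτ2 hτ3 using hex
  let cand : ℤ → ℕ → ℤ := fun t j => r + N * (t + Q * j)
  let E : ℤ → Set ((p : M) → ZMod ((p : Nat.Primes) : ℕ)) := fun t =>
    {v | ∀ j < J, ∃ p : M, (cand t j : ZMod ((p : Nat.Primes) : ℕ)) = v p}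
  have hEbound : ∀ t, P.real {ω | (fun p : M => X p ω) ∈ E t} ≤ 1 / (J * q) + 2 * A / y := by
    intro t
    have h1 : {ω | (fun p : M => X p ω) ∈ E t} =
        {ω | ∀ j < J, ω ∉ survives X M (cand t j)} := by
      ext ω
      simp only [E, survives, Set.mem_ofPred_eq, not_forall, not_not]
      exact forall₂_congr fun j _ => ⟨fun ⟨p, hp⟩ => ⟨p, p.2, hp⟩, fun ⟨p, hpM, hp⟩ =>
        ⟨⟨p, hpM⟩, hp⟩⟩
    rw [h1]
    refine measureReal_forall_notMem_le P hJ _ (fun j => hX.measurableSet_survives M _) hqpos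
      (by positivity) (fun j _ => hX.measureReal_survives M _) fun j hj j' hj' hne => ?_
    refine hX.measureReal_survives_inter_le hyM hy hA ?_
    have hcand : cand t j - cand t j' = N * Q * ((j : ℤ) - j') := by
      simp only [cand]
      ring
    rw [hcand]
    have h0 : (j : ℤ) - j' ≠ 0 := by
      rw [sub_ne_zero]
      exact_mod_cast hne
    refine le_trans (Finset.card_le_card fun p hp => ?_)
      (card_primes_dvd_le M hyM (A := A) h0 (by omega))
    rw [Finset.mem_filter] at hp ⊢
    refine ⟨hp.1, ?_⟩
    -- A prime `p > y ≥ N` divides neither `N` nor the primorial of `y`.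
    have hpy := hyM p hp.1
    have hpp : Prime ((p : ℕ) : ℤ) := Nat.prime_iff_prime_int.1 p.2
    rcases hpp.dvd_or_dvd hp.2 with h | h
    · exfalso
      rcases hpp.dvd_or_dvd h with h | h
      · have := Nat.le_of_dvd hN (Int.natCast_dvd_natCast.1 h)
        omega
      · have := (p.2.dvd_primorial_iff).1 (Int.natCast_dvd_natCast.1 h)
        omega
    · exact h
  have hmain := measureReal_mem_of_indep hindep
    (measurable_pi_lambda _ fun p => hX.measurable p) (τ := τ) (measurable_of_countable τ)
    (Finset.Ico s' (s' + Q)) (fun u => Finset.mem_Ico.2 ⟨hτ1 u, hτ2 u⟩) (E := E)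
    (fun t => (Set.toFinite _).measurableSet) (δ := 1 / (J * q) + 2 * A / y) (by positivity)
    (fun t _ => hEbound t)
  refine le_trans (measureReal_mono fun ω hω => ?_) hmain
  obtain ⟨hω1, hω2⟩ := hω
  intro j hj
  set t := τ fun p : S => X p ω with ht
  have hjJ : (j : ℤ) + 1 ≤ J := by exact_mod_cast hj
  have ht1 : s' ≤ t := hτ1 _
  have ht2 : t < s' + Q := hτ2 _
  have hcr : cand t j ≡ r [ZMOD N] := by
    simp only [cand]
    exact (Int.emod_emod_of_dvd _ dvd_rfl).symm.trans (by simp [Int.add_mul_emod_self_left])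
  have hj0 : (0 : ℤ) ≤ Q * j := by positivity
  obtain ⟨p, hpT, hp⟩ := hω2 (cand t j)
    (by
      simp only [cand]
      nlinarith)
    (by
      have h1 : t + Q * j + 1 ≤ s' + Q * J + Q := by nlinarith
      have h2 : (N : ℤ) * (t + Q * j + 1) ≤ N * (s' + Q * J + Q) :=
        mul_le_mul_of_nonneg_left h1 hNpos.le
      simp only [cand]
      linarith) hcr
  have hpN : ¬ (p : ℕ) ∣ N := fun hd => hω1 p hd <| by
    rw [← hp, ZMod.intCast_eq_intCast_iff]
    exact (hcr.of_dvd (Int.natCast_dvd_natCast.2 hd)).symm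
  have hpM : p ∈ M := by
    by_contra hpM
    have hpS : p ∈ S := by
      rw [hS, mem_primesIoc]
      refine ⟨p.2.pos, ?_⟩
      by_contra! hlt
      exact hpM (mem_primesIoc.2 ⟨hlt, hpT⟩)
    refine hτ3 (fun p : S => X p ω) ⟨p, hpS⟩ hpN ?_
    rw [← hp]
    have hQ0 : (Q : ZMod (p : ℕ)) = 0 := by
      rw [ZMod.natCast_eq_zero_iff]
      exact p.2.dvd_primorial_iff.2 (mem_primesIoc.1 hpS).2
    simp only [cand]
    push_cast
    rw [hQ0]
    ring
  exact ⟨⟨p, hpM⟩, hp⟩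

theorem scale_bound {k N : ℕ} (hk : 27 ≤ k) (hN : N ≤ 2 ^ (k - 3)) :
    N * (primorial (2 ^ (k - 3)) * (2 ^ (8 * k) + 1) + 1) ≤ 2 ^ 2 ^ k := by
  have h1 : primorial (2 ^ (k - 3)) ≤ 2 ^ 2 ^ (k - 2) := by
    refine (primorial_le_four_pow _).trans (le_of_eq ?_)
    rw [show (4 : ℕ) = 2 ^ 2 from rfl, ← pow_mul, ← pow_succ', show k - 3 + 1 = k - 2 by omega]
  have h2 : 9 * k + 2 ≤ 2 ^ (k - 2) := by
    obtain ⟨j, rfl⟩ := Nat.exists_eq_add_of_le hk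
    rw [show 27 + j - 2 = j + 25 by omega, pow_add]
    have := Nat.lt_two_pow_self (n := j)
    norm_num
    omega
  have h3 : 2 ^ k = 4 * 2 ^ (k - 2) := by
    rw [show (4 : ℕ) = 2 ^ 2 from rfl, ← pow_add]
    congr 1
    omega
  have h4 : 1 ≤ 2 ^ (8 * k) := Nat.one_le_two_pow
  calc N * (primorial (2 ^ (k - 3)) * (2 ^ (8 * k) + 1) + 1)
      ≤ 2 ^ k * (2 ^ 2 ^ (k - 2) * (2 ^ (8 * k) + 2 ^ (8 * k)) +
          2 ^ 2 ^ (k - 2) * (2 ^ (8 * k) + 2 ^ (8 * k))) := by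
        gcongr
        · exact hN.trans (Nat.pow_le_pow_right (by norm_num) (by omega))
        · exact Nat.one_le_iff_ne_zero.2 (by positivity)
    _ = 2 ^ (9 * k + 2 + 2 ^ (k - 2)) := by ring
    _ ≤ 2 ^ 2 ^ k := Nat.pow_le_pow_right (by norm_num) (by omega)

/-- At every large enough doubly exponential scale, an interval of length `2 ^ 2 ^ k` contains an
integer of given residue modulo `N` avoiding the residues of all primes up to `2 ^ (8 * 2 ^ k)`. -/
theorem IsUniformResidueFamily.ae_eventually_exists (hX : IsUniformResidueFamily P X)
    {N : ℕ} (hN : 0 < N) (r : ℤ) (s : ℕ → ℤ) :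
    ∀ᵐ ω ∂P, (∀ p : Nat.Primes, (p : ℕ) ∣ N → (r : ZMod (p : ℕ)) ≠ X p ω) →
      ∀ᶠ k in Filter.atTop, ∃ a : ℤ, s k ≤ a ∧ a < s k + 2 ^ 2 ^ k ∧ a ≡ r [ZMOD N] ∧
        ∀ p : Nat.Primes, (p : ℕ) ≤ 2 ^ (8 * 2 ^ k) → (a : ZMod (p : ℕ)) ≠ X p ω := by
  obtain ⟨c, hc, hprod⟩ := exists_le_prod_primesIoc
  let F : ℕ → Set Ω := fun k =>
    {ω | (∀ p : Nat.Primes, (p : ℕ) ∣ N → (r : ZMod (p : ℕ)) ≠ X p ω) ∧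
      ∀ a : ℤ, s k ≤ a → a < s k + N * (primorial (2 ^ (k - 3)) * ((2 ^ (8 * k) : ℕ) + 1) + 1) →
        a ≡ r [ZMOD N] →
        ∃ p : Nat.Primes, (p : ℕ) ≤ 2 ^ (8 * 2 ^ k) ∧ (a : ZMod (p : ℕ)) = X p ω}
  obtain ⟨k₀, hk₀, hNk₀⟩ : ∃ k₀, 27 ≤ k₀ ∧ N ≤ 2 ^ (k₀ - 3) :=
    ⟨N + 27, by omega, (Nat.lt_two_pow_self (n := N)).le.trans
      (Nat.pow_le_pow_right (by norm_num) (by omega))⟩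
  have hNk : ∀ k, k₀ ≤ k → N ≤ 2 ^ (k - 3) := fun k hk =>
    hNk₀.trans (Nat.pow_le_pow_right (by norm_num) (by omega))
  set C : ℝ := 8 ^ 6 / c + 128 with hC
  have hF : ∀ k, k₀ ≤ k → P.real (F k) ≤ C * (1 / 2) ^ k := by
    intro k hk
    -- There are `J = 2 ^ (8 * k)` candidates. As `J ≤ y ^ 9` for `y = 2 ^ (k - 3)`, differences
    -- have at most `8` prime factors above `y`, while `J` exceeds the inverse survival probability,
    -- which is `O(2 ^ (6 * k))`, by a factor of order `2 ^ (2 * k)`.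
    have h1 := hX.measureReal_sieve_fail_le (y := 2 ^ (k - 3)) (T := 2 ^ (8 * 2 ^ k))
      (J := 2 ^ (8 * k)) (A := 8) r (s k) hN (hNk k hk) (by positivity)
      (by rw [← pow_mul]; exact Nat.pow_le_pow_right (by norm_num) (by omega))
      (by
        calc 2 * 8 = 2 ^ 4 := by norm_num
          _ ≤ 2 ^ (k - 3) := Nat.pow_le_pow_right (by norm_num) (by omega))
    refine h1.trans ?_
    have h2 := hprod (8 * 2 ^ k) (2 ^ (k - 3)) (by
      have := Nat.one_le_two_pow (n := k)
      have : 2 ^ 1 ≤ 2 ^ k := Nat.pow_le_pow_right (by norm_num) (by omega)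
      omega)
    set q := ∏ p ∈ primesIoc (2 ^ (k - 3)) (2 ^ (8 * 2 ^ k)), (1 - 1 / ((p : ℕ) : ℝ)) with hq
    have hx : (1 : ℝ) ≤ 2 ^ k := one_le_pow₀ (by norm_num)
    have hxpos : (0 : ℝ) < 2 ^ k := by positivity
    have h3 : c / 8 ^ 6 * 2 ^ k ≤ ((2 ^ (8 * k) : ℕ) : ℝ) * q := by
      have h4 : ((2 ^ (8 * k) : ℕ) : ℝ) * (c / ((8 * 2 ^ k : ℕ) : ℝ) ^ 6) ≤
          ((2 ^ (8 * k) : ℕ) : ℝ) * q := mul_le_mul_of_nonneg_left h2 (by positivity)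
      refine le_trans ?_ h4
      have h5 : ((2 ^ (8 * k) : ℕ) : ℝ) = (2 ^ k) ^ 8 := by
        push_cast
        rw [← pow_mul, mul_comm]
      have h6 : ((2 ^ (8 * k) : ℕ) : ℝ) * (c / ((8 * 2 ^ k : ℕ) : ℝ) ^ 6) =
          c / 8 ^ 6 * (2 ^ k) ^ 2 := by
        rw [h5]
        push_cast
        field_simp
      rw [h6]
      have : 0 < c / 8 ^ 6 := by positivity
      nlinarith [mul_le_mul_of_nonneg_left hx hxpos.le]
    have h7 : 1 / (((2 ^ (8 * k) : ℕ) : ℝ) * q) ≤ 8 ^ 6 / c * (1 / 2) ^ k := by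
      refine (one_div_le_one_div_of_le (by positivity) h3).trans (le_of_eq ?_)
      rw [one_div_pow]
      field_simp
    have h8 : 2 * ((8 : ℕ) : ℝ) / ((2 ^ (k - 3) : ℕ) : ℝ) = 128 * (1 / 2) ^ k := by
      have h9 : (2 : ℝ) ^ k = 8 * 2 ^ (k - 3) := by
        rw [show (8 : ℝ) = 2 ^ 3 by norm_num, ← pow_add]
        congr 1
        omega
      rw [one_div_pow, h9]
      push_cast
      field_simp
      norm_num
    rw [h8, hC, add_mul]
    linarith
  have hsum : ∑' k, P (F (k + k₀)) ≠ ⊤ := by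
    have hs : Summable fun k => P.real (F (k + k₀)) := by
      refine Summable.of_nonneg_of_le (fun k => measureReal_nonneg)
        (fun k => hF (k + k₀) (by omega)) ?_
      exact ((summable_nat_add_iff k₀).2
        (summable_geometric_of_lt_one (by norm_num) (by norm_num))).mul_left C
    have := hs.tsum_ofReal_ne_top
    simpa [Measure.real, ENNReal.ofReal_toReal (measure_ne_top _ _)] using this
  filter_upwards [ae_eventually_notMem hsum] with ω hω hr
  rw [Filter.eventually_atTop] at hω ⊢
  obtain ⟨k₁, hk₁⟩ := hω
  refine ⟨k₁ + k₀, fun k hk => ?_⟩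
  have h1 := hk₁ (k - k₀) (by omega)
  rw [show k - k₀ + k₀ = k by omega] at h1
  by_contra! hcon
  refine h1 ⟨hr, fun a ha1 ha2 ha3 => hcon a ha1 (ha2.trans_le ?_) ha3⟩
  have h2 := scale_bound (k := k) (N := N) (by omega) (hNk k (by omega))
  have h3 : ((N * (primorial (2 ^ (k - 3)) * (2 ^ (8 * k) + 1) + 1) : ℕ) : ℤ) ≤
      ((2 ^ 2 ^ k : ℕ) : ℤ) := by exact_mod_cast h2
  push_cast at h3 ⊢
  linarith

end Sieve

/-! ### Coordinates on the lattice -/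

/-- Integer coordinates on an abelian group `A`: each `f i` maps onto `ℤ`, jointly they are
injective, and their joint image contains all multiples of `N > 0`. For a finite-index subgroup
of `ℤ ^ d` these are the standard coordinates, each divided by the generator of its image. -/
structure IsLatticeFrame {A : Type*} [AddCommGroup A] {d : ℕ} (f : Fin d → A →+ ℤ) (N : ℕ) :
    Prop where
  surjective : ∀ i, Function.Surjective (f i)
  ext : ∀ x y, (∀ i, f i x = f i y) → x = y
  pos : 0 < N
  exists_eq_mul : ∀ w : Fin d → ℤ, ∃ x, ∀ i, f i x = N * w i

theorem exists_surjective_of_ne_zero {A : Type*} [AddCommGroup A] (g : A →+ ℤ) (hg : ∃ x, g x ≠ 0) :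
    ∃ (f : A →+ ℤ) (m : ℤ), 0 < m ∧ Function.Surjective f ∧ ∀ x, g x = m * f x := by
  obtain ⟨a, ha⟩ := Int.subgroup_cyclic g.range
  have hmem : ∀ x, ∃ n : ℤ, g x = |a| * n := fun x => by
    have h1 : g x ∈ AddSubgroup.closure {a} := ha ▸ ⟨x, rfl⟩
    obtain ⟨n, hn⟩ := AddSubgroup.mem_closure_singleton.1 h1
    rw [smul_eq_mul] at hn
    exact (abs_dvd a (g x)).2 ⟨n, by rw [← hn, mul_comm]⟩
  have ha0 : 0 < |a| := by
    obtain ⟨x, hx⟩ := hg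
    rw [abs_pos]
    rintro rfl
    obtain ⟨n, hn⟩ := hmem x
    simp at hn
    exact hx hn
  choose f hf using hmem
  refine ⟨AddMonoidHom.mk' f fun x y => ?_, |a|, ha0, fun n => ?_, hf⟩
  · have := map_add g x y
    rw [hf, hf, hf, ← mul_add] at this
    exact mul_left_cancel₀ ha0.ne' this
  · have h1 : |a| * n ∈ g.range := by
      rw [ha, AddSubgroup.mem_closure_singleton]
      obtain ⟨t, ht⟩ := self_dvd_abs a
      exact ⟨t * n, by rw [smul_eq_mul, ht]; ring⟩
    obtain ⟨x, hx⟩ := h1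
    refine ⟨x, ?_⟩
    rw [hf] at hx
    exact mul_left_cancel₀ ha0.ne' hx

theorem exists_latticeFrame {d : ℕ} (Γ : AddSubgroup (Fin d → ℤ)) (hΓ : Γ.FiniteIndex) :
    ∃ (f : Fin d → Γ →+ ℤ) (N : ℕ) (m : Fin d → ℤ), IsLatticeFrame f N ∧ (∀ i, 0 < m i) ∧
      ∀ i (x : Γ), (x : Fin d → ℤ) i = m i * f i x := by
  have hN : 0 < Γ.index := Nat.pos_of_ne_zero hΓ.index_ne_zero
  have hmem : ∀ w : Fin d → ℤ, (Γ.index • w) ∈ Γ := fun w => Γ.nsmul_index_mem w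
  have h1 : ∀ i : Fin d, ∃ (f : Γ →+ ℤ) (m : ℤ), 0 < m ∧ Function.Surjective f ∧
      ∀ x : Γ, (x : Fin d → ℤ) i = m * f x := fun i =>
    exists_surjective_of_ne_zero ((Pi.evalAddMonoidHom (fun _ : Fin d => ℤ) i).comp Γ.subtype)
      ⟨⟨Γ.index • fun _ => 1, hmem _⟩, by simpa using hN.ne'⟩
  choose f m hm hf hfm using h1
  refine ⟨f, Γ.index, m, ⟨hf, fun x y h => ?_, hN, fun w => ?_⟩, hm, hfm⟩
  · ext i
    rw [hfm, hfm, h]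
  · refine ⟨⟨Γ.index • fun i => m i * w i, hmem _⟩, fun i => ?_⟩
    have := hfm i ⟨Γ.index • fun i => m i * w i, hmem _⟩
    simp only [Pi.smul_apply, nsmul_eq_mul] at this
    refine mul_left_cancel₀ (hm i).ne' (this.symm.trans ?_)
    ring

theorem card_quotient_multiples {d : ℕ} (Γ : AddSubgroup (Fin d → ℤ)) (hΓ : Γ.FiniteIndex)
    (n : ℕ) : Nat.card (Γ ⧸ multiples Γ n) = n ^ d := by
  have : Module.Free ℤ Γ := inferInstanceAs (Module.Free ℤ (AddSubgroup.toIntSubmodule Γ))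
  have : Module.Finite ℤ Γ := inferInstanceAs (Module.Finite ℤ (AddSubgroup.toIntSubmodule Γ))
  rw [← AddSubgroup.index_eq_card, multiples, AddSubgroup.index_range_nsmul,
    AddSubgroup.finrank_eq_of_finiteIndex]
  simp

variable {A : Type*} [AddCommGroup A]

/-- The map from cosets of `p A` to residues modulo `p` induced by a homomorphism `A →+ ℤ`. -/
def residue (g : A →+ ℤ) (p : ℕ) : A ⧸ multiples A p →+ ZMod p :=
  QuotientAddGroup.lift (multiples A p) ((Int.castAddHom (ZMod p)).comp g) <| by
    rintro _ ⟨x, rfl⟩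
    simp

theorem residue_mk (g : A →+ ℤ) (p : ℕ) (x : A) :
    residue g p (QuotientAddGroup.mk x) = (g x : ZMod p) := rfl

theorem residue_surjective {g : A →+ ℤ} (hg : Function.Surjective g) (p : ℕ) :
    Function.Surjective (residue g p) := fun c => by
  obtain ⟨n, rfl⟩ := ZMod.intCast_surjective c
  obtain ⟨x, rfl⟩ := hg n
  exact ⟨QuotientAddGroup.mk x, residue_mk g p x⟩

section Random

variable {Ω : Type*} [MeasurableSpace Ω] {P : Measure Ω}
  {B : (p : Nat.Primes) → Ω → A ⧸ multiples A (p : ℕ)}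

theorem IsUniformCosetFamily.measureReal_eq (hB : IsUniformCosetFamily P B) (p : Nat.Primes)
    (c : A ⧸ multiples A (p : ℕ)) :
    P.real {ω | B p ω = c} = 1 / (Nat.card (A ⧸ multiples A (p : ℕ)) : ℝ) := by
  rw [Measure.real, hB.uniform, ENNReal.toReal_inv, ENNReal.toReal_natCast, one_div]

/-- The residues of a surjective coordinate on uniform independent cosets are uniform and
independent. -/
theorem IsUniformCosetFamily.residues [IsProbabilityMeasure P] (hB : IsUniformCosetFamily P B)
    (hfin : ∀ p : Nat.Primes, Finite (A ⧸ multiples A (p : ℕ)))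
    {g : A →+ ℤ} (hg : Function.Surjective g) :
    IsUniformResidueFamily P fun p ω => residue g p (B p ω) where
  measurable p := by
    have h2 : Measurable[⊤, ⊤] (residue g p) := measurable_from_top
    exact h2.comp (hB.measurable p)
  uniform p c := by
    classical
    have := hfin p
    have : Fintype (A ⧸ multiples A (p : ℕ)) := Fintype.ofFinite _
    have : NeZero (p : ℕ) := ⟨p.2.pos.ne'⟩
    have hm : ∀ x, MeasurableSet {ω | B p ω = x} := fun x =>
      hB.measurable p (t := {x}) MeasurableSpace.measurableSet_top
    have key : ∀ c : ZMod (p : ℕ), P.real {ω | residue g p (B p ω) = c} =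
        ((Finset.univ.filter fun x => residue g p x = c).card : ℝ) *
          (1 / (Nat.card (A ⧸ multiples A (p : ℕ)) : ℝ)) := by
      intro c
      have h1 : {ω | residue g p (B p ω) = c} =
          ⋃ x ∈ Finset.univ.filter fun x => residue g p x = c,
            {ω | B p ω = x} := by
        ext ω
        simp
      rw [h1, measureReal_biUnion_finset _ fun x _ => hm x]
      · simp [hB.measureReal_eq]
      · intro x _ y _ hxy
        exact Set.disjoint_left.2 fun ω (h1 : B p ω = x) (h2 : B p ω = y) =>
          hxy (h1.symm.trans h2)
    have hsum : (Nat.card (A ⧸ multiples A (p : ℕ)) : ℝ) =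
        p * (Finset.univ.filter fun x => residue g p x = c).card := by
      have h1 : Nat.card (A ⧸ multiples A (p : ℕ)) = ∑ c' : ZMod (p : ℕ),
          (Finset.univ.filter fun x => residue g p x = c').card := by
        rw [Nat.card_eq_fintype_card, ← Finset.card_univ]
        exact Finset.card_eq_sum_card_fiberwise fun x _ => Finset.mem_coe.2 (Finset.mem_univ _)
      have h2 : ∀ c' : ZMod (p : ℕ),
          (Finset.univ.filter fun x => residue g p x = c').card =
          (Finset.univ.filter fun x => residue g p x = c).card := fun c' =>
        AddMonoidHom.card_fiber_eq_of_mem_range (residue g p)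
          (residue_surjective hg p c') (residue_surjective hg p c)
      rw [h1, Finset.sum_congr rfl fun c' _ => h2 c']
      simp [ZMod.card]
    have hcard : (0 : ℝ) < Nat.card (A ⧸ multiples A (p : ℕ)) := by
      exact_mod_cast Nat.card_pos
    have hp : (0 : ℝ) < (p : ℕ) := by exact_mod_cast p.2.pos
    rw [key, mul_one_div, div_eq_div_iff hcard.ne' hp.ne', hsum]
    ring
  indep := by
    have := hB.indep.comp (mγ := fun p : Nat.Primes => ZMod.instMeasurableSpace (p : ℕ))
      (fun p : Nat.Primes => residue g (p : ℕ))
      (fun p => measurable_from_top)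
    exact this

/-! ### Large primes -/

theorem IsLatticeFrame.box_finite {d N : ℕ} {f : Fin d → A →+ ℤ} (hf : IsLatticeFrame f N)
    (R : ℤ) : {x | ∀ i, |f i x| ≤ R}.Finite := by
  refine Set.Finite.of_finite_image (f := fun x i => f i x) ?_
    fun x _ y _ h => hf.ext x y fun i => congrFun h i
  refine (Fintype.piFinset fun _ : Fin d => Finset.Icc (-R) R).finite_toSet.subset ?_
  rintro _ ⟨x, hx, rfl⟩
  rw [Finset.mem_coe, Fintype.mem_piFinset]
  exact fun i => Finset.mem_Icc.2 (abs_le.1 (hx i))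

theorem IsLatticeFrame.card_box_le {d N : ℕ} {f : Fin d → A →+ ℤ} (hf : IsLatticeFrame f N)
    (R : ℕ) : (hf.box_finite R).toFinset.card ≤ (2 * R + 1) ^ d := by
  classical
  have h1 : (hf.box_finite R).toFinset.card ≤
      (Fintype.piFinset fun _ : Fin d => Finset.Icc (-(R : ℤ)) R).card := by
    refine Finset.card_le_card_of_injOn (fun x i => f i x) (fun x hx => ?_)
      fun x _ y _ h => hf.ext x y fun i => congrFun h i
    rw [Finset.mem_coe, Fintype.mem_piFinset]
    have hx' := (Set.Finite.mem_toFinset _).1 (Finset.mem_coe.1 hx)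
    exact fun i => Finset.mem_Icc.2 (abs_le.1 (hx' i))
  refine h1.trans (le_of_eq ?_)
  rw [Fintype.card_piFinset]
  simp
  congr 1
  omega

/-- Almost surely, all but finitely many of the cosets `B p` avoid the box of radius
`8 * p ^ (1/4)`. -/
theorem IsUniformCosetFamily.ae_finite_setOf_meets_box [IsProbabilityMeasure P]
    (hB : IsUniformCosetFamily P B) {d N : ℕ} {f : Fin d → A →+ ℤ} (hf : IsLatticeFrame f N)
    (hd : 2 ≤ d) (hcard : ∀ n : ℕ, Nat.card (A ⧸ multiples A n) = n ^ d) :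
    ∀ᵐ ω ∂P, {p : Nat.Primes | ∃ v : A,
      (∀ i, |f i v| ≤ ((8 * Nat.sqrt (Nat.sqrt p) : ℕ) : ℤ)) ∧
        QuotientAddGroup.mk v = B p ω}.Finite := by
  let F : Nat.Primes → Set Ω := fun p => {ω | ∃ v : A,
      (∀ i, |f i v| ≤ ((8 * Nat.sqrt (Nat.sqrt p) : ℕ) : ℤ)) ∧ QuotientAddGroup.mk v = B p ω}
  have hF : ∀ p, P.real (F p) ≤ 17 ^ d * (1 / ((p : ℕ) : ℝ) ^ (3 / 2 : ℝ)) := by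
    intro p
    set ρ := Nat.sqrt (Nat.sqrt p) with hρ
    have hp1 : 1 ≤ (p : ℕ) := p.2.one_lt.le
    have hρ1 : 1 ≤ ρ := Nat.le_sqrt'.2 (by simpa using Nat.le_sqrt'.2 (by simpa using hp1))
    have hsub : F p ⊆ ⋃ v ∈ (hf.box_finite (8 * ρ : ℕ)).toFinset,
        {ω | B p ω = QuotientAddGroup.mk v} := by
      rintro ω ⟨v, hv, hω⟩
      simp only [Set.mem_iUnion]
      exact ⟨v, (Set.Finite.mem_toFinset _).2 hv, hω.symm⟩
    have hp0 : (0 : ℝ) < (p : ℕ) := by exact_mod_cast hp1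
    have hp1' : (1 : ℝ) ≤ (p : ℕ) := by exact_mod_cast hp1
    have h1 : P.real (F p) ≤ ((2 * (8 * ρ) + 1) ^ d : ℕ) * (1 / ((p : ℕ) : ℝ) ^ d) := by
      calc P.real (F p) ≤ _ := measureReal_mono hsub (measure_ne_top _ _)
        _ ≤ ∑ v ∈ (hf.box_finite (8 * ρ : ℕ)).toFinset,
              P.real {ω | B p ω = QuotientAddGroup.mk v} := measureReal_biUnion_finset_le _ _
        _ = (hf.box_finite (8 * ρ : ℕ)).toFinset.card * (1 / ((p : ℕ) : ℝ) ^ d) := by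
            simp [hB.measureReal_eq, hcard]
        _ ≤ _ := by
            have := hf.card_box_le (8 * ρ)
            have h2 : ((hf.box_finite (8 * ρ : ℕ)).toFinset.card : ℝ) ≤
              ((2 * (8 * ρ) + 1) ^ d : ℕ) := by exact_mod_cast this
            gcongr
    have h2 : ((2 * (8 * ρ) + 1) ^ d : ℕ) ≤ (17 : ℝ) ^ d * (ρ : ℝ) ^ d := by
      rw [← mul_pow]
      have : (2 * (8 * ρ) + 1) ^ d ≤ (17 * ρ) ^ d := Nat.pow_le_pow_left (by omega) d
      exact_mod_cast this
    have hρs : (ρ : ℝ) ^ 2 ≤ ((p : ℕ) : ℝ) ^ (1 / 2 : ℝ) := by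
      rw [← Real.sqrt_eq_rpow]
      refine le_trans ?_ (Real.nat_sqrt_le_real_sqrt (a := (p : ℕ)))
      exact_mod_cast Nat.sqrt_le' _
    have hρp : (ρ : ℝ) / (p : ℕ) ≤ 1 := by
      rw [div_le_one hp0]
      have := (Nat.sqrt_le_self (Nat.sqrt p)).trans (Nat.sqrt_le_self p)
      exact_mod_cast this
    have h3 : ((ρ : ℝ) / (p : ℕ)) ^ d ≤ 1 / ((p : ℕ) : ℝ) ^ (3 / 2 : ℝ) := by
      calc ((ρ : ℝ) / (p : ℕ)) ^ d ≤ ((ρ : ℝ) / (p : ℕ)) ^ 2 :=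
            pow_le_pow_of_le_one (by positivity) hρp hd
        _ = (ρ : ℝ) ^ 2 / ((p : ℕ) : ℝ) ^ 2 := div_pow _ _ _
        _ ≤ ((p : ℕ) : ℝ) ^ (1 / 2 : ℝ) / ((p : ℕ) : ℝ) ^ 2 := by gcongr
        _ = 1 / ((p : ℕ) : ℝ) ^ (3 / 2 : ℝ) := by
            rw [div_eq_div_iff (by positivity) (by positivity), one_mul, ← Real.rpow_add hp0]
            norm_num
    calc P.real (F p) ≤ ((2 * (8 * ρ) + 1) ^ d : ℕ) * (1 / ((p : ℕ) : ℝ) ^ d) := h1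
      _ ≤ (17 : ℝ) ^ d * (ρ : ℝ) ^ d * (1 / ((p : ℕ) : ℝ) ^ d) := by gcongr
      _ = 17 ^ d * ((ρ : ℝ) / (p : ℕ)) ^ d := by rw [div_pow]; ring
      _ ≤ _ := by gcongr
  have hsum : ∑' p, P (F p) ≠ ⊤ := by
    have hs : Summable fun p => P.real (F p) := by
      refine Summable.of_nonneg_of_le (fun k => measureReal_nonneg) hF ?_
      refine Summable.mul_left _ ?_
      exact (Real.summable_one_div_nat_rpow.2 (by norm_num : (1 : ℝ) < 3 / 2)).comp_injective
        (i := fun p : Nat.Primes => (p : ℕ)) Subtype.val_injective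
    have := hs.tsum_ofReal_ne_top
    simpa [Measure.real, ENNReal.ofReal_toReal (measure_ne_top _ _)] using this
  exact ae_finite_setOfPred_mem hsum

end Random

/-! ### Paths inside a set of vertices -/

/-- `u` and `v` are joined by a walk of `G` all of whose vertices lie in `U`. -/
def Linked {V : Type*} (G : SimpleGraph V) (U : Set V) (u v : V) : Prop :=
  ∃ w : G.Walk u v, ∀ x ∈ w.support, x ∈ U

section Linked

variable {V : Type*} {G : SimpleGraph V} {U U' : Set V} {u v x : V}

theorem Linked.mem_left (h : Linked G U u v) : u ∈ U :=
  let ⟨w, hw⟩ := h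
  hw _ w.start_mem_support

theorem Linked.mem_right (h : Linked G U u v) : v ∈ U :=
  let ⟨w, hw⟩ := h
  hw _ w.end_mem_support

theorem Linked.trans (h : Linked G U u v) (h' : Linked G U v x) : Linked G U u x := by
  obtain ⟨w, hw⟩ := h
  obtain ⟨w', hw'⟩ := h'
  refine ⟨w.append w', fun y hy => ?_⟩
  rcases (SimpleGraph.Walk.mem_support_append_iff _ _).1 hy with hy | hy
  · exact hw y hy
  · exact hw' y hy

theorem Linked.mono (h : Linked G U u v) (hU : U ⊆ U') : Linked G U' u v :=
  let ⟨w, hw⟩ := h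
  ⟨w, fun y hy => hU (hw y hy)⟩

theorem Linked.reachable (h : Linked G U u v) (hu : u ∈ U) (hv : v ∈ U) :
    (G.induce U).Reachable ⟨u, hu⟩ ⟨v, hv⟩ :=
  let ⟨w, hw⟩ := h
  ⟨w.induce U hw⟩

end Linked

variable {S : Set A} {hS : Admissible S}

theorem Linked.translate {U U' : Set A} {u v : A} (h : Linked (cayleyGraph S hS) U u v) (t : A)
    (hU : ∀ x ∈ U, x + t ∈ U') : Linked (cayleyGraph S hS) U' (u + t) (v + t) := by
  obtain ⟨w, hw⟩ := h
  let φ : cayleyGraph S hS →g cayleyGraph S hS :=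
    ⟨fun x => x + t, fun {a b} hab => by
      change a + t - (b + t) ∈ S
      rwa [add_sub_add_right_eq_sub]⟩
  refine ⟨w.map φ, fun x hx => ?_⟩
  rw [SimpleGraph.Walk.support_map, List.mem_map] at hx
  obtain ⟨y, hy, rfl⟩ := hx
  exact hU y (hw y hy)

/-! ### Connectivity of hyperplanes inside boxes -/

variable {d N : ℕ} {f : Fin d → A →+ ℤ}

theorem exists_forall_abs_le_of_finite (f : Fin d → A →+ ℤ) {s : Set A} (hs : s.Finite) :
    ∃ C : ℤ, 0 ≤ C ∧ ∀ x ∈ s, ∀ j, |f j x| ≤ C := by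
  obtain ⟨C, hC⟩ := (hs.image fun x => ∑ j, |f j x|).bddAbove
  refine ⟨max C 0, le_max_right _ _, fun x hx j => le_trans ?_ (le_max_left _ _)⟩
  refine le_trans ?_ (hC ⟨x, hx, rfl⟩)
  exact Finset.single_le_sum (f := fun j => |f j x|) (fun j _ => abs_nonneg _) (Finset.mem_univ j)

theorem exists_linked_zero
    (hconn : ∀ i, ((cayleyGraph S hS).induce {x | f i x = 0}).Connected) (i : Fin d) (x : A)
    (hx : f i x = 0) :
    ∃ C : ℤ, 0 ≤ C ∧ Linked (cayleyGraph S hS) {y | f i y = 0 ∧ ∀ j, |f j y| ≤ C} 0 x := by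
  obtain ⟨w⟩ := (hconn i).preconnected ⟨0, map_zero (f i)⟩ ⟨x, hx⟩
  let φ := (SimpleGraph.Embedding.induce (G := cayleyGraph S hS) {x | f i x = 0}).toHom
  have hker : ∀ y ∈ (w.map φ).support, f i y = 0 := fun y hy => by
    rw [SimpleGraph.Walk.support_map, List.mem_map] at hy
    obtain ⟨z, _, rfl⟩ := hy
    exact z.2
  obtain ⟨C, hC0, hC⟩ := exists_forall_abs_le_of_finite f (List.finite_toSet (w.map φ).support)
  exact ⟨C, hC0, w.map φ, fun y hy => ⟨hker y hy, hC y hy⟩⟩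

/-- Two points of a box on the same hyperplane `f i = const` are joined inside the hyperplane by
a path leaving the box by at most a constant: far away points are brought closer by steps
of size `N` along the axes, each realized by one of finitely many paths up to translation. -/
theorem IsLatticeFrame.exists_linked_hyperplane (hf : IsLatticeFrame f N)
    (hconn : ∀ i, ((cayleyGraph S hS).induce {x | f i x = 0}).Connected) :
    ∃ C : ℤ, 0 ≤ C ∧ ∀ (i : Fin d) (R : ℤ) (u v : A), f i u = f i v → (∀ j, |f j u| ≤ R) →
      (∀ j, |f j v| ≤ R) →
      Linked (cayleyGraph S hS) {x | f i x = f i u ∧ ∀ j, |f j x| ≤ R + C} u v := by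
  have h1 : ∀ (i : Fin d) (x : A), ∃ C : ℤ, 0 ≤ C ∧ (f i x = 0 →
      Linked (cayleyGraph S hS) {y | f i y = 0 ∧ ∀ j, |f j y| ≤ C} 0 x) := by
    intro i x
    by_cases hx : f i x = 0
    · obtain ⟨C, hC0, hC⟩ := exists_linked_zero hconn i x hx
      exact ⟨C, hC0, fun _ => hC⟩
    · exact ⟨0, le_rfl, fun h => absurd h hx⟩
  choose c hc0 hc using h1
  obtain ⟨C, hC⟩ := (((Set.finite_univ (α := Fin d)).prod (hf.box_finite N)).image
    fun q => c q.1 q.2).bddAbove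
  -- Displacements of size at most `N` in the hyperplane are realized within distance `C`.
  have hstep : ∀ (i : Fin d) (R : ℤ) (u w : A), (∀ j, |f j u| ≤ R) → f i w = 0 →
      (∀ j, |f j w| ≤ N) → Linked (cayleyGraph S hS)
        {x | f i x = f i u ∧ ∀ j, |f j x| ≤ R + max C 0} u (w + u) := by
    intro i R u w hu hw hwN
    have h2 := (hc i w hw).translate (U' := {x | f i x = f i u ∧ ∀ j, |f j x| ≤ R + max C 0}) u
      (fun x hx => by
        refine ⟨by rw [map_add, hx.1, zero_add], fun j => ?_⟩
        rw [map_add]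
        have h3 : c i w ≤ C := hC ⟨(i, w), ⟨Set.mem_univ _, hwN⟩, rfl⟩
        have h4 := hx.2 j
        have h5 := hu j
        have := abs_add_le (f j x) (f j u)
        have := le_max_left C 0
        linarith)
    rwa [zero_add] at h2
  refine ⟨max C 0, le_max_right _ _, fun i R u v huv hu hv => ?_⟩
  obtain ⟨n, hn⟩ : ∃ n : ℕ, ∑ j, |f j v - f j u| ≤ n :=
    ⟨(∑ j, |f j v - f j u|).toNat, Int.self_le_toNat _⟩
  induction n generalizing u with
  | zero =>
    have h0 : ∀ j, f j v - f j u = 0 := fun j => by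
      have := Finset.single_le_sum (f := fun j => |f j v - f j u|) (fun j _ => abs_nonneg _)
        (Finset.mem_univ j)
      have h3 : |f j v - f j u| ≤ 0 := by simpa using this.trans hn
      exact abs_eq_zero.1 (le_antisymm h3 (abs_nonneg _))
    have : v = u := hf.ext v u fun j => by linarith [h0 j]
    have h3 := hstep i R u 0 hu (map_zero _) (fun j => by simp)
    rw [zero_add] at h3
    exact this ▸ h3
  | succ n ih =>
    by_cases hall : ∀ j, |f j (v - u)| ≤ N
    · have h3 := hstep i R u (v - u) hu (by rw [map_sub, huv, sub_self]) hall
      rwa [sub_add_cancel] at h3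
    · push Not at hall
      obtain ⟨j, hj⟩ := hall
      have hN := hf.pos
      have hNz : (0 : ℤ) < N := by exact_mod_cast hN
      have hij : i ≠ j := by
        rintro rfl
        rw [map_sub, huv, sub_self, abs_zero] at hj
        omega
      rw [map_sub] at hj
      have hσ : ∃ σ : ℤ, |σ| = 1 ∧ |f j v - (N * σ + f j u)| < |f j v - f j u| ∧
          |N * σ + f j u| ≤ R := by
        have hu' := abs_le.1 (hu j)
        have hv' := abs_le.1 (hv j)
        rcases le_total 0 (f j v - f j u) with h | h
        · rw [abs_of_nonneg h] at hj
          refine ⟨1, abs_one, ?_, ?_⟩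
          · rw [abs_of_nonneg h, abs_lt]
            constructor <;> linarith
          · rw [abs_le]
            constructor <;> linarith
        · rw [abs_of_nonpos h] at hj
          refine ⟨-1, by simp, ?_, ?_⟩
          · rw [abs_of_nonpos h, abs_lt]
            constructor <;> linarith
          · rw [abs_le]
            constructor <;> linarith
      obtain ⟨σ, hσ1, hσ2, hσ3⟩ := hσ
      obtain ⟨e, he⟩ := hf.exists_eq_mul (Pi.single j σ)
      have hej : f j e = N * σ := by rw [he, Pi.single_eq_same]
      have hel : ∀ l, l ≠ j → f l e = 0 := fun l hl => by
        rw [he, Pi.single_eq_of_ne hl, mul_zero]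
      have h3 := hstep i R u e hu (hel i hij) (fun l => by
        by_cases hl : l = j
        · subst hl
          rw [hej, abs_mul, hσ1, mul_one, Nat.abs_cast]
        · rw [hel l hl, abs_zero]
          exact hNz.le)
      have hi : f i (e + u) = f i u := by rw [map_add, hel i hij, zero_add]
      have h4 := ih (e + u) (hi.trans huv) (fun l => by
        rw [map_add]
        by_cases hl : l = j
        · subst hl
          rw [hej]
          exact hσ3
        · rw [hel l hl, zero_add]
          exact hu l) (by
        have : ∑ l, |f l v - f l (e + u)| < ∑ l, |f l v - f l u| := by
          refine Finset.sum_lt_sum (fun l _ => ?_) ⟨j, Finset.mem_univ j, ?_⟩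
          · by_cases hl : l = j
            · subst hl
              rw [map_add, hej]
              exact hσ2.le
            · rw [map_add, hel l hl, zero_add]
          · rw [map_add, hej]
            exact hσ2
        push_cast at hn
        linarith)
      rw [hi] at h4
      exact h3.trans h4

/-! ### Compatible residues for the separating hyperplanes -/

/-- Given a residue `r₀` of the coordinate `f i₀` that differs from those of the cosets `b p`, some
vertex on `f i₀ = r₀` has a `j`-th coordinate that also differs from those of `b p`, for all
`p` in a finite set. If it were impossible modulo `q`, then `f j` would be a multiple of `f i₀`
modulo `q`, and the two conditions at `q` would be equivalent. -/
theorem IsLatticeFrame.exists_residue_ne (hf : IsLatticeFrame f N)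
    (b : (p : Nat.Primes) → A ⧸ multiples A (p : ℕ)) (i₀ j : Fin d) (r₀ : ℤ)
    (D : Finset Nat.Primes) (hr₀ : ∀ p ∈ D, (r₀ : ZMod (p : ℕ)) ≠ residue (f i₀) p (b p)) :
    ∃ x, f i₀ x = r₀ ∧ ∀ p ∈ D, (f j x : ZMod (p : ℕ)) ≠ residue (f j) p (b p) := by
  classical
  induction D using Finset.induction_on with
  | empty =>
    obtain ⟨x, hx⟩ := hf.surjective i₀ r₀
    exact ⟨x, hx, by simp⟩
  | insert q s hq ih =>
    obtain ⟨x, hx, hxs⟩ := ih fun p hp => hr₀ p (Finset.mem_insert_of_mem hp)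
    by_cases h : (f j x : ZMod (q : ℕ)) = residue (f j) q (b q)
    · obtain ⟨k, hk0, hkq⟩ : ∃ k, f i₀ k = 0 ∧ ¬ ((q : ℕ) : ℤ) ∣ f j k := by
        by_contra! hcon
        obtain ⟨β, hβ⟩ := QuotientAddGroup.mk_surjective (b q)
        have h1 : ((q : ℕ) : ℤ) ∣ f j x - f j β := by
          rw [← hβ, residue_mk, eq_comm] at h
          exact (ZMod.intCast_eq_intCast_iff_dvd_sub _ _ _).1 h
        have h2 : ¬ ((q : ℕ) : ℤ) ∣ r₀ - f i₀ β := fun h2 =>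
          hr₀ q (Finset.mem_insert_self q s) <| by
            rw [← hβ, residue_mk, eq_comm]
            exact (ZMod.intCast_eq_intCast_iff_dvd_sub _ _ _).2 h2
        obtain ⟨z, hz⟩ := hf.surjective j 1
        have h3 := hcon ((r₀ - f i₀ β) • z - f i₀ z • (x - β)) (by
          simp only [map_sub, map_zsmul, smul_eq_mul, hx]
          ring)
        simp only [map_sub, map_zsmul, smul_eq_mul, hz, mul_one] at h3
        exact h2 ((dvd_sub_left (h1.mul_left _)).1 h3)
      refine ⟨x + (∏ p ∈ s, (p : ℕ)) • k, by simp [hx, hk0], fun p hp => ?_⟩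
      rcases Finset.mem_insert.1 hp with rfl | hp
      · rw [← h]
        intro h0
        have h1 : ((p : ℕ) : ℤ) ∣ ((∏ x ∈ s, (x : ℕ) : ℕ) : ℤ) * f j k := by
          rw [eq_comm] at h0
          have := (ZMod.intCast_eq_intCast_iff_dvd_sub _ _ _).1 h0
          simpa using this
        rcases (Nat.prime_iff_prime_int.1 p.2).dvd_or_dvd h1 with h2 | h2
        · exact not_dvd_prod_of_notMem hq (Int.natCast_dvd_natCast.1 h2)
        · exact hkq h2
      · have h1 : ((∏ x ∈ s, (x : ℕ) : ℕ) : ZMod (p : ℕ)) = 0 := by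
          rw [ZMod.natCast_eq_zero_iff]
          exact Finset.dvd_prod_of_mem (fun x : Nat.Primes => (x : ℕ)) hp
        have h2 : ((f j (x + (∏ p ∈ s, (p : ℕ)) • k) : ℤ) : ZMod (p : ℕ)) = (f j x : ℤ) := by
          rw [map_add, map_nsmul, nsmul_eq_mul, Int.cast_add, Int.cast_mul, Int.cast_natCast, h1,
            zero_mul, add_zero]
        rw [h2]
        exact hxs p hp
    · refine ⟨x, hx, fun p hp => ?_⟩
      rcases Finset.mem_insert.1 hp with rfl | hp
      · exact h
      · exact hxs p hp

/-- One residue `r i` for each coordinate such that it differs from that of `b p` whenever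
`p ∣ N` and such that `f i₀ = r i₀` and `f j = r j` have a common solution `h j` for each `j`. -/
theorem IsLatticeFrame.exists_compatible_residues (hf : IsLatticeFrame f N)
    (b : (p : Nat.Primes) → A ⧸ multiples A (p : ℕ)) (i₀ : Fin d) :
    ∃ (r : Fin d → ℤ) (h : Fin d → A), (∀ j, f i₀ (h j) = r i₀) ∧ (∀ j, f j (h j) = r j) ∧
      ∀ j (p : Nat.Primes), (p : ℕ) ∣ N → (r j : ZMod (p : ℕ)) ≠ residue (f j) p (b p) := by
  have hD : ∀ p : Nat.Primes, (p : ℕ) ∣ N → p ∈ primesIoc 0 N := fun p hp =>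
    mem_primesIoc.2 ⟨p.2.pos, Nat.le_of_dvd hf.pos hp⟩
  obtain ⟨r₀, hr₀⟩ := exists_int_avoiding (primesIoc 0 N) fun p => residue (f i₀) p (b p)
  choose h h1 h2 using fun j => hf.exists_residue_ne b i₀ j r₀ (primesIoc 0 N) hr₀
  exact ⟨fun j => f j (h j), h, fun j => (h1 j).trans (h1 i₀).symm, fun j => rfl,
    fun j p hp => h2 j p (hD p hp)⟩

/-! ### Shells of white plates -/

/-- The `k`-th spatial scale. -/
def scale (k : ℕ) : ℤ := 2 ^ 2 ^ k

theorem scale_pos (k : ℕ) : 0 < scale k := by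
  unfold scale
  positivity

theorem scale_succ (k : ℕ) : scale (k + 1) = scale k ^ 2 := by
  unfold scale
  rw [← pow_mul, pow_succ]

theorem scale_mono : Monotone scale := fun _ _ h =>
  pow_le_pow_right₀ (by norm_num) (Nat.pow_le_pow_right (by norm_num) h)

theorem natCast_lt_scale (k : ℕ) : (k : ℤ) < scale k := by
  unfold scale
  exact_mod_cast (Nat.lt_two_pow_self (n := k)).trans (Nat.lt_two_pow_self (n := 2 ^ k))

theorem two_le_scale (k : ℕ) : 2 ≤ scale k := by
  have := scale_mono (Nat.zero_le k)
  simpa [scale] using this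

theorem exists_scale_gt (M : ℤ) (k₀ : ℕ) : ∃ k, k₀ ≤ k ∧ M < scale k := by
  refine ⟨k₀ + M.toNat, by omega, ?_⟩
  have := natCast_lt_scale (k₀ + M.toNat)
  push_cast at this
  omega

/-- The left end of the interval of length `scale k` in which the hyperplane of sign `σ`
at scale `k` is sought. -/
def plateStart (σ : Bool) (k : ℕ) : ℤ := if σ then scale k else -(2 * scale k)

/-- The part of the hyperplane `f i = a` in the box of radius `R`. -/
def plate (f : Fin d → A →+ ℤ) (i : Fin d) (a R : ℤ) : Set A :=
  {v | f i v = a ∧ ∀ j, |f j v| ≤ R}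

theorem eq_or_eq_of_le_of_le (hsurj : ∀ i, Function.Surjective (f i))
    (hcross : ∀ i (x z : A), (cayleyGraph S hS).Adj x z → f i x ≤ 0 → 0 ≤ f i z →
      f i x = 0 ∨ f i z = 0)
    {i : Fin d} {x z : A} {a : ℤ} (h : (cayleyGraph S hS).Adj x z) (hx : f i x ≤ a)
    (hz : a ≤ f i z) : f i x = a ∨ f i z = a := by
  obtain ⟨t, rfl⟩ := hsurj i a
  have h' : (cayleyGraph S hS).Adj (x - t) (z - t) := by
    change x - t - (z - t) ∈ S
    rw [sub_sub_sub_cancel_right]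
    exact h
  have := hcross i _ _ h' (by rw [map_sub]; linarith) (by rw [map_sub]; linarith)
  rwa [map_sub, map_sub, sub_eq_zero, sub_eq_zero] at this

/-- White plates at all large scales: for each coordinate `i` and sign `σ`, the hyperplane
`f i = a k i σ` is contained in `W` within the box of radius `8 * scale k ^ 2`, and the numbers
`a k i σ` have prescribed residues `r i` modulo `N`. Only the part of radius `4 * scale k ^ 2` is
used to build shells; the margin makes that part connected inside `W`. -/
structure IsShellFamily (f : Fin d → A →+ ℤ) (N : ℕ) (W : Set A) (r : Fin d → ℤ) (k₀ : ℕ)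
    (a : ℕ → Fin d → Bool → ℤ) : Prop where
  start_le : ∀ k, k₀ ≤ k → ∀ i σ, plateStart σ k ≤ a k i σ
  lt_end : ∀ k, k₀ ≤ k → ∀ i σ, a k i σ < plateStart σ k + scale k
  modEq : ∀ k, k₀ ≤ k → ∀ i σ, a k i σ ≡ r i [ZMOD N]
  subset : ∀ k, k₀ ≤ k → ∀ i σ, plate f i (a k i σ) (8 * scale k ^ 2) ⊆ W

section Shell

variable {W : Set A} {r : Fin d → ℤ} {k₀ : ℕ} {a : ℕ → Fin d → Bool → ℤ}

theorem IsShellFamily.mono (ha : IsShellFamily f N W r k₀ a) {k₁ : ℕ} (h : k₀ ≤ k₁) :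
    IsShellFamily f N W r k₁ a :=
  ⟨fun k hk => ha.start_le k (h.trans hk), fun k hk => ha.lt_end k (h.trans hk),
    fun k hk => ha.modEq k (h.trans hk), fun k hk => ha.subset k (h.trans hk)⟩

theorem IsShellFamily.abs_le (ha : IsShellFamily f N W r k₀ a) {k : ℕ} (hk : k₀ ≤ k) (i : Fin d)
    (σ : Bool) : |a k i σ| ≤ 2 * scale k := by
  have h1 := ha.start_le k hk i σ
  have h2 := ha.lt_end k hk i σ
  have h3 := scale_pos k
  rw [_root_.abs_le]
  cases σ <;> simp only [plateStart, if_true, Bool.false_eq_true, if_false] at h1 h2 <;>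
    constructor <;> linarith

theorem IsShellFamily.le_true (ha : IsShellFamily f N W r k₀ a) {k : ℕ} (hk : k₀ ≤ k)
    (i : Fin d) : scale k ≤ a k i true := by
  simpa [plateStart] using ha.start_le k hk i true

theorem IsShellFamily.false_lt (ha : IsShellFamily f N W r k₀ a) {k : ℕ} (hk : k₀ ≤ k)
    (i : Fin d) : a k i false < -scale k := by
  have := ha.lt_end k hk i false
  simp only [plateStart, Bool.false_eq_true, if_false] at this
  linarith

theorem exists_inter_plates (hf : IsLatticeFrame f N) {h : Fin d → A} {i₀ j : Fin d}
    (hij : j ≠ i₀) {a₀ a₁ R R' : ℤ} (h0 : a₀ ≡ f i₀ (h j) [ZMOD N]) (h1 : a₁ ≡ f j (h j) [ZMOD N])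
    (hR : ∀ l, |f l (h j)| ≤ R) (hR' : ∀ l, |f l (h j)| ≤ R') (ha₀ : |a₀| ≤ R) (ha₀' : |a₀| ≤ R')
    (ha₁ : |a₁| ≤ R) (ha₁' : |a₁| ≤ R') : (plate f i₀ a₀ R ∩ plate f j a₁ R').Nonempty := by
  classical
  obtain ⟨w₀, hw₀⟩ := h0.symm.dvd
  obtain ⟨w₁, hw₁⟩ := h1.symm.dvd
  obtain ⟨x, hx⟩ := hf.exists_eq_mul (Function.update (Pi.single i₀ w₀) j w₁)
  have e0 : f i₀ (h j + x) = a₀ := by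
    rw [map_add, hx, Function.update_of_ne hij.symm, Pi.single_eq_same, ← hw₀]
    ring
  have e1 : f j (h j + x) = a₁ := by
    rw [map_add, hx, Function.update_self, ← hw₁]
    ring
  have el : ∀ l, l ≠ i₀ → l ≠ j → f l (h j + x) = f l (h j) := fun l hl hl' => by
    rw [map_add, hx, Function.update_of_ne hl', Pi.single_eq_of_ne hl, mul_zero, add_zero]
  have key : ∀ R'', (∀ l, |f l (h j)| ≤ R'') → |a₀| ≤ R'' → |a₁| ≤ R'' →
      ∀ l, |f l (h j + x)| ≤ R'' := by
    intro R'' k1 k2 k3 l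
    by_cases hl : l = i₀
    · subst hl
      rwa [e0]
    · by_cases hl' : l = j
      · subst hl'
        rwa [e1]
      · rw [el l hl hl']
        exact k1 l
  exact ⟨h j + x, ⟨e0, key R hR ha₀ ha₁⟩, ⟨e1, key R' hR' ha₀' ha₁'⟩⟩

/-- Since the hyperplane in coordinate `i₀` meets all the others, at its own scale and at the next
one, all plates of a family of shells belong to one cluster of `W`. -/
theorem IsShellFamily.exists_linked (ha : IsShellFamily f N W r k₀ a) (hf : IsLatticeFrame f N)
    (hconn : ∀ i, ((cayleyGraph S hS).induce {x | f i x = 0}).Connected)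
    {i₀ i₁ : Fin d} (hi : i₁ ≠ i₀) {h : Fin d → A} (hr₀ : ∀ j, f i₀ (h j) = r i₀)
    (hr : ∀ j, f j (h j) = r j) :
    ∃ k₁, k₀ ≤ k₁ ∧ ∃ v₀, v₀ ∈ plate f i₀ (a k₁ i₀ true) (4 * scale k₁ ^ 2) ∧
      ∀ k, k₁ ≤ k → ((plate f i₀ (a k i₀ true) (4 * scale k ^ 2)).Nonempty ∧
        ∀ i σ, ∀ u ∈ plate f i (a k i σ) (4 * scale k ^ 2),
          Linked (cayleyGraph S hS) W v₀ u) := by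
  obtain ⟨C, hC0, hC⟩ := hf.exists_linked_hyperplane hconn
  obtain ⟨H, hH0, hH⟩ := exists_forall_abs_le_of_finite f (Set.finite_range h)
  obtain ⟨k₁, hk₁, hscale⟩ := exists_scale_gt (C + H) k₀
  have hbig : ∀ k, k₁ ≤ k → C + H < scale k := fun k hk => hscale.trans_le (scale_mono hk)
  have hcore : ∀ k, k₁ ≤ k → ∀ i σ, ∀ u ∈ plate f i (a k i σ) (4 * scale k ^ 2),
      ∀ v ∈ plate f i (a k i σ) (4 * scale k ^ 2), Linked (cayleyGraph S hS) W u v := by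
    intro k hk i σ u hu v hv
    refine (hC i _ u v (hu.1.trans hv.1.symm) hu.2 hv.2).mono fun x hx =>
      ha.subset k (hk₁.trans hk) i σ ⟨hx.1.trans hu.1, fun j => (hx.2 j).trans ?_⟩
    have := hbig k hk
    have := two_le_scale k
    nlinarith
  have hmeet : ∀ k k', k₁ ≤ k → k₁ ≤ k' → scale k ≤ scale k' → scale k' ≤ scale k ^ 2 →
      ∀ σ σ' j, j ≠ i₀ → (plate f i₀ (a k i₀ σ) (4 * scale k ^ 2) ∩
        plate f j (a k' j σ') (4 * scale k' ^ 2)).Nonempty := by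
    intro k k' hk hk' h1 h2 σ σ' j hj
    have b1 := hbig k hk
    have b2 := hbig k' hk'
    have c1 := two_le_scale k
    have c2 := two_le_scale k'
    have d1 := ha.abs_le (hk₁.trans hk) i₀ σ
    have d2 := ha.abs_le (hk₁.trans hk') j σ'
    have hHj : ∀ l, |f l (h j)| ≤ H := hH (h j) ⟨j, rfl⟩
    refine exists_inter_plates hf hj ?_ ?_ (fun l => (hHj l).trans ?_)
      (fun l => (hHj l).trans ?_) (d1.trans ?_) (d1.trans ?_) (d2.trans ?_) (d2.trans ?_)
    · rw [hr₀]
      exact ha.modEq k (hk₁.trans hk) i₀ σ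
    · rw [hr]
      exact ha.modEq k' (hk₁.trans hk') j σ'
    all_goals nlinarith
  have hself : ∀ k, scale k ≤ scale k ^ 2 := fun k => by nlinarith [two_le_scale k]
  obtain ⟨v₀, hv₀, -⟩ := hmeet k₁ k₁ le_rfl le_rfl le_rfl (hself _) true true i₁ hi
  refine ⟨k₁, hk₁, v₀, hv₀, ?_⟩
  let Good : ℕ → Fin d → Bool → Prop := fun k i σ =>
    ∀ u ∈ plate f i (a k i σ) (4 * scale k ^ 2), Linked (cayleyGraph S hS) W v₀ u
  have hpass : ∀ k k' i j σ σ', k₁ ≤ k' → (plate f i (a k i σ) (4 * scale k ^ 2) ∩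
      plate f j (a k' j σ') (4 * scale k' ^ 2)).Nonempty → Good k i σ → Good k' j σ' := by
    rintro k k' i j σ σ' hk' ⟨x, hx, hx'⟩ hg u hu
    exact (hg x hx).trans (hcore k' hk' j σ' x hx' u hu)
  have hlevel : ∀ k, k₁ ≤ k → Good k i₀ true → ∀ i σ, Good k i σ := by
    intro k hk hg
    have h1 : ∀ j, j ≠ i₀ → ∀ σ, Good k j σ := fun j hj σ =>
      hpass k k i₀ j true σ hk (hmeet k k hk hk le_rfl (hself k) true σ j hj) hg
    intro i σ
    by_cases hi' : i = i₀
    · subst hi'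
      refine hpass k k i₁ i true σ hk ?_ (h1 i₁ hi true)
      rw [Set.inter_comm]
      exact hmeet k k hk hk le_rfl (hself k) σ true i₁ hi
    · exact h1 i hi' σ
  intro k hk
  refine ⟨(hmeet k k hk hk le_rfl (hself k) true true i₁ hi).mono Set.inter_subset_left, ?_⟩
  induction k, hk using Nat.le_induction with
  | base => exact hlevel k₁ le_rfl fun u hu => hcore k₁ le_rfl i₀ true v₀ hv₀ u hu
  | succ k hk ih =>
    have hk' : k₁ ≤ k + 1 := hk.trans (Nat.le_succ k)
    have h1 : Good (k + 1) i₁ true := hpass k (k + 1) i₀ i₁ true true hk'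
      (hmeet k (k + 1) hk hk' (scale_mono (Nat.le_succ k)) (scale_succ k).le true true i₁ hi)
      (ih i₀ true)
    refine hlevel (k + 1) hk' (hpass (k + 1) (k + 1) i₁ i₀ true true hk' ?_ h1)
    rw [Set.inter_comm]
    exact hmeet (k + 1) (k + 1) hk' hk' le_rfl (hself _) true true i₁ hi

/-- An infinite cluster of any set of vertices meets one of the plates: it leaves a shell
surrounding one of its points, and cannot jump over the hyperplanes. -/
theorem IsShellFamily.exists_mem_plate (ha : IsShellFamily f N W r k₀ a) (hf : IsLatticeFrame f N)
    (hcross : ∀ i (x z : A), (cayleyGraph S hS).Adj x z → f i x ≤ 0 → 0 ≤ f i z →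
      f i x = 0 ∨ f i z = 0)
    {U : Set A} (C : ((cayleyGraph S hS).induce U).ConnectedComponent) (hC : C.supp.Infinite) :
    ∃ k, k₀ ≤ k ∧ ∃ i σ, ∃ y : U, (y : A) ∈ plate f i (a k i σ) (4 * scale k ^ 2) ∧
      ((cayleyGraph S hS).induce U).connectedComponentMk y = C := by
  classical
  obtain ⟨u, hu⟩ := hC.nonempty
  obtain ⟨H, hH0, hH⟩ := exists_forall_abs_le_of_finite f (Set.finite_singleton (u : A))
  obtain ⟨D, hD0, hD⟩ := exists_forall_abs_le_of_finite f hS.finite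
  obtain ⟨k, hk, hscale⟩ := exists_scale_gt (H + D) k₀
  set I : Set U := {x | ∀ i, a k i false < f i x ∧ f i x < a k i true} with hI
  have habs : ∀ x ∈ I, ∀ i, |f i x| ≤ 2 * scale k := by
    intro x hx i
    have h1 := _root_.abs_le.1 (ha.abs_le hk i true)
    have h2 := _root_.abs_le.1 (ha.abs_le hk i false)
    have h3 := hx i
    rw [_root_.abs_le]
    constructor <;> linarith
  have hIfin : I.Finite := by
    refine Set.Finite.of_finite_image (f := Subtype.val)
      ((hf.box_finite (2 * scale k)).subset ?_) Subtype.val_injective.injOn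
    rintro _ ⟨x, hx, rfl⟩
    exact habs x hx
  have huI : u ∈ I := fun i => by
    have h1 := _root_.abs_le.1 (hH u rfl i)
    have h2 := ha.le_true hk i
    have h3 := ha.false_lt hk i
    constructor <;> linarith
  obtain ⟨v, hv, hvI⟩ := hC.exists_notMem_finite hIfin
  have hu' : ((cayleyGraph S hS).induce U).connectedComponentMk u = C := hu
  have hv' : ((cayleyGraph S hS).induce U).connectedComponentMk v = C := hv
  obtain ⟨w⟩ := SimpleGraph.ConnectedComponent.exact (hu'.trans hv'.symm)
  obtain ⟨e, he, he1, he2⟩ := w.exists_boundary_dart I huI hvI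
  have hadj : (cayleyGraph S hS).Adj (e.fst : A) (e.snd : A) := e.adj
  have hstep : ∀ j, |f j e.snd| ≤ 4 * scale k ^ 2 := fun j => by
    have h1 := _root_.abs_le.1 (habs _ he1 j)
    have h2 := _root_.abs_le.1 (hD _ hadj j)
    rw [map_sub] at h2
    have h3 := two_le_scale k
    rw [_root_.abs_le]
    constructor <;> nlinarith
  have hcomp : ((cayleyGraph S hS).induce U).connectedComponentMk e.snd = C := by
    rw [← hu']
    have hmem : e.snd ∈ w.support := w.dart_snd_mem_support_of_mem_darts he
    exact SimpleGraph.ConnectedComponent.sound ⟨(w.takeUntil e.snd hmem).reverse⟩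
  have hout : ∃ i, f i e.snd ≤ a k i false ∨ a k i true ≤ f i e.snd := by
    by_contra! hcon
    exact he2 hcon
  obtain ⟨i, hi | hi⟩ := hout
  · refine ⟨k, hk, i, false, e.snd, ⟨?_, hstep⟩, hcomp⟩
    rcases eq_or_eq_of_le_of_le hf.surjective hcross hadj.symm hi (he1 i).1.le with h | h
    · exact h
    · exact absurd h (he1 i).1.ne'
  · refine ⟨k, hk, i, true, e.snd, ⟨?_, hstep⟩, hcomp⟩
    rcases eq_or_eq_of_le_of_le hf.surjective hcross hadj (he1 i).2.le hi with h | h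
    · exact absurd h (he1 i).2.ne
    · exact h

theorem IsShellFamily.numInfiniteClusters_compl (ha : IsShellFamily f N W r k₀ a)
    (hf : IsLatticeFrame f N)
    (hcross : ∀ i (x z : A), (cayleyGraph S hS).Adj x z → f i x ≤ 0 → 0 ≤ f i z →
      f i x = 0 ∨ f i z = 0) : numInfiniteClusters (cayleyGraph S hS) Wᶜ = 0 := by
  rw [numInfiniteClusters, Set.encard_eq_zero, Set.eq_empty_iff_forall_notMem]
  intro C hC
  obtain ⟨k, hk, i, σ, y, hy, -⟩ := ha.exists_mem_plate hf hcross C hC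
  refine y.2 (ha.subset k hk i σ ⟨hy.1, fun j => (hy.2 j).trans ?_⟩)
  nlinarith [scale_pos k]

theorem IsShellFamily.numInfiniteClusters_eq_one (ha : IsShellFamily f N W r k₀ a)
    (hf : IsLatticeFrame f N)
    (hconn : ∀ i, ((cayleyGraph S hS).induce {x | f i x = 0}).Connected)
    (hcross : ∀ i (x z : A), (cayleyGraph S hS).Adj x z → f i x ≤ 0 → 0 ≤ f i z →
      f i x = 0 ∨ f i z = 0)
    {i₀ i₁ : Fin d} (hi : i₁ ≠ i₀) {h : Fin d → A} (hr₀ : ∀ j, f i₀ (h j) = r i₀)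
    (hr : ∀ j, f j (h j) = r j) : numInfiniteClusters (cayleyGraph S hS) W = 1 := by
  obtain ⟨k₁, hk₁, v₀, hv₀, hlink⟩ := ha.exists_linked hf hconn hi hr₀ hr
  have hv₀W : v₀ ∈ W := ((hlink k₁ le_rfl).2 i₀ true v₀ hv₀).mem_left
  set C₀ := ((cayleyGraph S hS).induce W).connectedComponentMk ⟨v₀, hv₀W⟩ with hC₀
  have hmem : ∀ u (hu : u ∈ W), Linked (cayleyGraph S hS) W v₀ u →
      ((cayleyGraph S hS).induce W).connectedComponentMk ⟨u, hu⟩ = C₀ := fun u hu hl =>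
    SimpleGraph.ConnectedComponent.sound (hl.reachable hv₀W hu).symm
  rw [numInfiniteClusters, Set.encard_eq_one]
  refine ⟨C₀, Set.eq_singleton_iff_unique_mem.2 ⟨?_, fun C hC => ?_⟩⟩
  · -- The cluster contains points with arbitrarily large coordinate `f i₀`.
    intro hfin
    obtain ⟨M, hM⟩ := (hfin.image fun x : W => f i₀ x).bddAbove
    obtain ⟨k, hk, hMk⟩ := exists_scale_gt M k₁
    obtain ⟨⟨u, hu⟩, hl⟩ := hlink k hk
    have hl' := hl i₀ true u hu
    have h1 : f i₀ u ≤ M := hM ⟨⟨u, hl'.mem_right⟩, hmem u hl'.mem_right hl', rfl⟩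
    have h2 := ha.le_true (hk₁.trans hk) i₀
    rw [hu.1] at h1
    linarith
  · obtain ⟨k, hk, i, σ, y, hy, hyC⟩ := (ha.mono hk₁).exists_mem_plate hf hcross C hC
    rw [← hyC]
    exact hmem y y.2 ((hlink k hk).2 i σ y hy)

end Shell

/-! ### Almost sure existence of white shells -/

/-- A coset `B p` meeting a hyperplane forces the residue of the hyperplane, which the sieve
excludes for small `p`; the cosets of large `p` do not come near the origin. -/
theorem IsUniformCosetFamily.ae_forall_exists_shellFamily {Ω : Type*} [MeasurableSpace Ω]
    {P : Measure Ω} [IsProbabilityMeasure P] {B : (p : Nat.Primes) → Ω → A ⧸ multiples A (p : ℕ)}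
    (hB : IsUniformCosetFamily P B) (hf : IsLatticeFrame f N) (hd : 2 ≤ d)
    (hcard : ∀ n : ℕ, Nat.card (A ⧸ multiples A n) = n ^ d) :
    ∀ᵐ ω ∂P, ∀ r : Fin d → ℤ,
      (∀ j (p : Nat.Primes), (p : ℕ) ∣ N → (r j : ZMod (p : ℕ)) ≠ residue (f j) p (B p ω)) →
      ∃ k₀ a, IsShellFamily f N (white fun p => B p ω) r k₀ a := by
  have hfin : ∀ p : Nat.Primes, Finite (A ⧸ multiples A (p : ℕ)) := fun p =>
    Nat.finite_of_card_ne_zero (by rw [hcard]; exact pow_ne_zero _ p.2.pos.ne')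
  have hsieve : ∀ᵐ ω ∂P, ∀ (i : Fin d) (σ : Bool) (r : ℤ),
      (∀ p : Nat.Primes, (p : ℕ) ∣ N → (r : ZMod (p : ℕ)) ≠ residue (f i) p (B p ω)) →
      ∀ᶠ k in Filter.atTop, ∃ a : ℤ, plateStart σ k ≤ a ∧ a < plateStart σ k + 2 ^ 2 ^ k ∧
        a ≡ r [ZMOD N] ∧ ∀ p : Nat.Primes, (p : ℕ) ≤ 2 ^ (8 * 2 ^ k) →
          (a : ZMod (p : ℕ)) ≠ residue (f i) p (B p ω) :=
    ae_all_iff.2 fun i => ae_all_iff.2 fun σ => ae_all_iff.2 fun r =>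
      (hB.residues hfin (hf.surjective i)).ae_eventually_exists hf.pos r (plateStart σ)
  filter_upwards [hsieve, hB.ae_finite_setOf_meets_box hf hd hcard] with ω h1 h2 r hr
  obtain ⟨K, hK⟩ := (h2.image fun p : Nat.Primes => (p : ℕ)).bddAbove
  have h3 : ∀ᶠ k in Filter.atTop, ∀ i σ, ∃ a : ℤ, plateStart σ k ≤ a ∧
      a < plateStart σ k + 2 ^ 2 ^ k ∧ a ≡ r i [ZMOD N] ∧
      ∀ p : Nat.Primes, (p : ℕ) ≤ 2 ^ (8 * 2 ^ k) →
        (a : ZMod (p : ℕ)) ≠ residue (f i) p (B p ω) :=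
    Filter.eventually_all.2 fun i => Filter.eventually_all.2 fun σ => h1 i σ (r i) (hr i)
  obtain ⟨k₁, hk₁⟩ := Filter.eventually_atTop.1 h3
  choose! a ha1 ha2 ha3 ha4 using hk₁
  refine ⟨max k₁ K, a, fun k hk => ha1 k (le_of_max_le_left hk),
    fun k hk => ha2 k (le_of_max_le_left hk), fun k hk => ha3 k (le_of_max_le_left hk),
    fun k hk i σ v hv p hp => ?_⟩
  have hpv : QuotientAddGroup.mk v = B p ω := hp
  by_cases hpk : (p : ℕ) ≤ 2 ^ (8 * 2 ^ k)
  · refine ha4 k (le_of_max_le_left hk) i σ p hpk ?_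
    rw [← hpv, residue_mk, hv.1]
  · push Not at hpk
    have hpK : (p : ℕ) ≤ K := by
      refine hK ⟨p, ⟨v, fun j => (hv.2 j).trans ?_, hpv⟩, rfl⟩
      have h5 : (2 ^ 2 ^ k) ^ 2 ≤ Nat.sqrt (Nat.sqrt p) := by
        rw [Nat.le_sqrt', Nat.le_sqrt']
        refine le_trans (le_of_eq ?_) hpk.le
        rw [← pow_mul, ← pow_mul, ← pow_mul]
        congr 1
        ring
      have h6 : (((2 ^ 2 ^ k) ^ 2 : ℕ) : ℤ) ≤ (Nat.sqrt (Nat.sqrt p) : ℕ) := by exact_mod_cast h5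
      push_cast at h6 ⊢
      unfold scale
      linarith
    have h7 : k < 2 ^ (8 * 2 ^ k) :=
      (Nat.lt_two_pow_self (n := k)).trans_le (Nat.pow_le_pow_right (by norm_num) (by
        have := Nat.lt_two_pow_self (n := k)
        omega))
    have := le_of_max_le_right hk
    omega

end CoprimePercolation

theorem theorem5p3 {d : ℕ} (hd : 2 ≤ d)
    (Γ : AddSubgroup (Fin d → ℤ)) (hΓ : Γ.FiniteIndex)
    (S : Set Γ) (hS : CoprimePercolation.Admissible S)
    (hconn : ∀ i : Fin d,
      ((CoprimePercolation.cayleyGraph S hS).induce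
        {x : Γ | (x : Fin d → ℤ) i = 0}).Connected)
    (hcross : ∀ i : Fin d, ∀ x z : Γ, (CoprimePercolation.cayleyGraph S hS).Adj x z →
      (x : Fin d → ℤ) i ≤ 0 → 0 ≤ (z : Fin d → ℤ) i →
      (x : Fin d → ℤ) i = 0 ∨ (z : Fin d → ℤ) i = 0)
    {Ω : Type*} [MeasurableSpace Ω] (P : Measure Ω) [IsProbabilityMeasure P]
    (B : (p : Nat.Primes) → Ω → Γ ⧸ CoprimePercolation.multiples Γ (p : ℕ))
    (hB : CoprimePercolation.IsUniformCosetFamily P B) :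
    ∀ᵐ ω ∂P,
      CoprimePercolation.numInfiniteClusters (CoprimePercolation.cayleyGraph S hS)
        (CoprimePercolation.white fun p => B p ω) = 1 ∧
      CoprimePercolation.numInfiniteClusters (CoprimePercolation.cayleyGraph S hS)
        (CoprimePercolation.white fun p => B p ω)ᶜ = 0 := by
  obtain ⟨f, N, m, hf, hm, hfm⟩ := CoprimePercolation.exists_latticeFrame Γ hΓ
  have hconn' : ∀ i, ((CoprimePercolation.cayleyGraph S hS).induce {x | f i x = 0}).Connected := by
    intro i
    have : {x : Γ | (x : Fin d → ℤ) i = 0} = {x | f i x = 0} := by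
      ext x
      change (x : Fin d → ℤ) i = 0 ↔ f i x = 0
      rw [hfm, mul_eq_zero, or_iff_right (hm i).ne']
    rw [← this]
    exact hconn i
  have hcross' : ∀ i (x z : Γ), (CoprimePercolation.cayleyGraph S hS).Adj x z → f i x ≤ 0 →
      0 ≤ f i z → f i x = 0 ∨ f i z = 0 := by
    intro i x z hadj hx hz
    have h := hcross i x z hadj
    rw [hfm, hfm, mul_eq_zero, mul_eq_zero, or_iff_right (hm i).ne',
      or_iff_right (hm i).ne'] at h
    exact h (mul_nonpos_of_nonneg_of_nonpos (hm i).le hx) (mul_nonneg (hm i).le hz)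
  have hne : (⟨1, by omega⟩ : Fin d) ≠ ⟨0, by omega⟩ := by simp
  filter_upwards [hB.ae_forall_exists_shellFamily hf hd
    (CoprimePercolation.card_quotient_multiples Γ hΓ)] with ω hω
  obtain ⟨r, h, hr₀, hr, hres⟩ :=
    hf.exists_compatible_residues (fun p => B p ω) ⟨0, by omega⟩
  obtain ⟨k₀, a, ha⟩ := hω r hres
  exact ⟨ha.numInfiniteClusters_eq_one hf hconn' hcross' hne hr₀ hr,
    ha.numInfiniteClusters_compl hf hcross'⟩
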